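/- **Rightward open mean payoff games.** For $m\in\mathbb{N}$ let $[m]=\{1,\dots,m\}$. A *rightward open mean payoff game* (roMPG) $\mathcal{A}:m\to n$ consists of a finite set $Q$ of positions, a set of edges $E\subseteq([m]+Q)\times([n]+Q)$, a role function $\rho:Q\to\{\exists,\forall\}$ and a weight function $w:Q\to\mathbb{R}$, such that each entrance $i\in[m]$ has exactly one successor and each exit $j\in[n]$ has at most one predecessor. Two roMPGs $m\to n$ are isomorphic if there is a bijection between their positions that, extended by the identity on open ends, preserves and reflects edges and preserves roles and weights. The following operations are well defined on isomorphism classes of roMPGs. * For $\mathcal{A}:m\to l$ and $\mathcal{B}:l\to n$, the game $\mathcal{A};\mathcal{B}:m\to n$ has positions $Q^{\mathcal{A}}+Q^{\mathcal{B}}$; its edges are the edges of $\mathcal{A}$ that end in $Q^{\mathcal{A}}$, the edges of $\mathcal{B}$ that start in $Q^{\mathcal{B}}$, and the pairs $(s,s')$ with $(s,j)\in E^{\mathcal{A}}$ and $(j,s')\in E^{\mathcal{B}}$ for some $j\in[l]$. * For $\mathcal{A}:m\to n$ and $\mathcal{B}:k\to l$, the game $\mathcal{A}\oplus\mathcal{B}:m+k\to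 n+l$ is the juxtaposition of $\mathcal{A}$ and $\mathcal{B}$, with the open ends of $\mathcal{A}$ first. * For $\mathcal{A}:l+m\to l+n$, the trace $\mathrm{tr}_{l}(\mathcal{A}):m\to n$ has the positions of $\mathcal{A}$ and an edge from $s$ to $s'$ iff there are $k\ge 0$ and $i_1,\dots,i_k\in[l]$ with $\bar s\to i_1\to\cdots\to i_k\to\bar s'$ in $\mathcal{A}$, where $\bar{\ }$ shifts open ends by $l$ and fixes positions. * $\mathrm{id}_m:m\to m$ and $\sigma_{m,n}:m+n\to n+m$ are the games without positions whose edges are those of the identity and of the block swap. **The category $\mathbf{oMPG}=\mathrm{Int}(\mathbf{roMPG})$.** Its objects are pairs $m=(m_r,m_l)$ of natural numbers. An arrow $(m_r,m_l)\to(n_r,n_l)$ is an isomorphism class of roMPGs $m_r+n_l\to n_r+m_l$. The identity on $m$ is $\mathrm{id}_{m_r+m_l}$. The composite of $\mathcal{A}:m\to l$ and $\mathcal{B}:l\to n$ is $$\mathrm{tr}_{l_l}\big((\sigma_{l_l,m_r}\oplus\mathrm{id}_{n_l});(\mathcal{A}\oplus\mathrm{id}_{n_l});(\mathrm{id}_{l_r}\oplus\sigma_{m_l,n_l});(\mathcal{B}\oplus\mathrm{id}_{m_l});(\sigma_{n_r,l_l}\oplus\mathrm{id}_{m_l})\big).$$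 On objects put $m\oplus k=(m_r+k_r,\,k_l+m_l)$. For arrows $\mathcal{A}:m\to n$ and $\mathcal{B}:k\to l$ let $\mathcal{A}\oplus\mathcal{B}:m\oplus k\to n\oplus l$ be $$(\sigma_{m_r,k_r}\oplus\sigma_{l_l,n_l});(\mathrm{id}_{k_r}\oplus\mathcal{A}\oplus\mathrm{id}_{l_l});(\sigma_{k_r,n_r}\oplus\sigma_{m_l,l_l});(\mathrm{id}_{n_r}\oplus\mathcal{B}\oplus\mathrm{id}_{m_l}).$$ **Theorem.** $\mathbf{oMPG}$, with these identities and this composition, is a category, and it is a compact closed category, i.e. a symmetric monoidal category in which every object has a dual. More precisely, it is a strict symmetric monoidal category with tensor product $\oplus$, unit object $(0,0)$ and symmetry $\sigma_{m_r,k_r}\oplus\sigma_{m_l,k_l}:m\oplus k\to k\oplus m$, and every object $m=(m_r,m_l)$ has the dual $m^*=(m_l,m_r)$, whose unit $d:(0,0)\to m\oplus m^*$ and counit $e:m^*\oplus m\to(0,0)$ are given by the roMPGs $\mathrm{id}_{m_r+m_l}$ and $\mathrm{id}_{m_l+m_r}$ and satisfy the triangle identities. -/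

import Mathlib

open CategoryTheory MonoidalCategory

universe v u

/-! ### Rightward open mean payoff games -/

/-- The two players of a mean payoff game. -/
inductive Role : Type
  | eve
  | adam

/-- A rightward open mean payoff game from `m` to `n`. The entrances are the elements of `Fin m`,
the exits are the elements of `Fin n`, `Q` is the finite set of positions. -/
structure ROMPG (m n : ℕ) : Type 1 where
  /-- positions -/
  Q : Type
  finite_positions : Finite Q
  /-- edges, a subset of `([m] + Q) × ([n] + Q)` -/
  edge : Fin m ⊕ Q → Fin n ⊕ Q → Prop
  /-- each entrance has exactly one successor -/
  entrance_succ : ∀ i : Fin m, ∃! t, edge (Sum.inl i) t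
  /-- each exit has at most one predecessor -/
  exit_pred : ∀ (j : Fin n) (s s' : Fin m ⊕ Q),
    edge s (Sum.inl j) → edge s' (Sum.inl j) → s = s'
  role : Q → Role
  weight : Q → ℝ

namespace ROMPG

/-- Two rightward open games of the same arity are isomorphic if there is a bijection between
their positions that preserves edges, roles and weights and fixes the open ends. -/
def Iso {m n : ℕ} (A B : ROMPG m n) : Prop :=
  ∃ η : A.Q ≃ B.Q,
    (∀ s t, A.edge s t ↔ B.edge (s.map id η) (t.map id η)) ∧
    (∀ q, A.role q = B.role (η q)) ∧
    (∀ q, A.weight q = B.weight (η q))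

instance setoid (m n : ℕ) : Setoid (ROMPG m n) where
  r := Iso
  iseqv :=
    { refl := fun A => ⟨Equiv.refl _, by simp, by simp, by simp⟩
      symm := by
        rintro A B ⟨η, h1, h2, h3⟩
        refine ⟨η.symm, fun s t => ?_, fun q => ?_, fun q => ?_⟩
        · rw [h1]; simp
        · rw [h2]; simp
        · rw [h3]; simp
      trans := by
        rintro A B C ⟨η, h1, h2, h3⟩ ⟨θ, k1, k2, k3⟩
        refine ⟨η.trans θ, fun s t => ?_, fun q => ?_, fun q => ?_⟩
        · rw [h1, k1]; simp [Sum.map_map, Equiv.coe_trans]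
        · rw [h2, k2]; simp
        · rw [h3, k3]; simp }

/-- The game without positions whose edges are given by a bijection from entrances to exits. -/
def wires {m n : ℕ} (e : Fin m ≃ Fin n) : ROMPG m n where
  Q := Empty
  finite_positions := inferInstance
  edge
    | Sum.inl i, Sum.inl j => e i = j
    | Sum.inl _, Sum.inr q => q.elim
    | Sum.inr q, _ => q.elim
  entrance_succ i := by
    refine ⟨Sum.inl (e i), rfl, ?_⟩
    rintro (j | q) h
    · exact congrArg Sum.inl (Eq.symm h)
    · exact q.elim
  exit_pred j := by
    rintro (i | q) (i' | q') h h'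
    · exact congrArg Sum.inl (e.injective (Eq.trans h (Eq.symm h')))
    · exact q'.elim
    · exact q.elim
    · exact q.elim
  role q := q.elim
  weight q := q.elim

/-- Edges of the sequential composition: the exits of `A` are connected to the corresponding
entrances of `B` and hidden. -/
def seqEdge {m l n : ℕ} (A : ROMPG m l) (B : ROMPG l n) :
    Fin m ⊕ (A.Q ⊕ B.Q) → Fin n ⊕ (A.Q ⊕ B.Q) → Prop
  | Sum.inl i, Sum.inr (Sum.inl q) => A.edge (Sum.inl i) (Sum.inr q)
  | Sum.inr (Sum.inl p), Sum.inr (Sum.inl q) => A.edge (Sum.inr p) (Sum.inr q)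
  | Sum.inl i, Sum.inl k => ∃ j, A.edge (Sum.inl i) (Sum.inl j) ∧ B.edge (Sum.inl j) (Sum.inl k)
  | Sum.inl i, Sum.inr (Sum.inr q) =>
      ∃ j, A.edge (Sum.inl i) (Sum.inl j) ∧ B.edge (Sum.inl j) (Sum.inr q)
  | Sum.inr (Sum.inl p), Sum.inl k =>
      ∃ j, A.edge (Sum.inr p) (Sum.inl j) ∧ B.edge (Sum.inl j) (Sum.inl k)
  | Sum.inr (Sum.inl p), Sum.inr (Sum.inr q) =>
      ∃ j, A.edge (Sum.inr p) (Sum.inl j) ∧ B.edge (Sum.inl j) (Sum.inr q)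
  | Sum.inr (Sum.inr p), Sum.inl k => B.edge (Sum.inr p) (Sum.inl k)
  | Sum.inr (Sum.inr p), Sum.inr (Sum.inr q) => B.edge (Sum.inr p) (Sum.inr q)
  | Sum.inr (Sum.inr _), Sum.inr (Sum.inl _) => False

/-- Sequential composition. -/
def seq {m l n : ℕ} (A : ROMPG m l) (B : ROMPG l n) : ROMPG m n where
  Q := A.Q ⊕ B.Q
  finite_positions := by
    have := A.finite_positions
    have := B.finite_positions
    infer_instance
  edge := seqEdge A B
  entrance_succ i := by
    obtain ⟨t, ht, hu⟩ := A.entrance_succ i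
    rcases t with j | q
    · obtain ⟨t', ht', hu'⟩ := B.entrance_succ j
      have key : ∀ j', A.edge (Sum.inl i) (Sum.inl j') → j' = j := fun j' h =>
        Sum.inl.inj (hu _ h)
      rcases t' with k | q
      · refine ⟨Sum.inl k, ⟨j, ht, ht'⟩, ?_⟩
        rintro (k' | q' | q') h
        · obtain ⟨j', h1, h2⟩ := h
          obtain rfl := key j' h1
          exact congrArg Sum.inl (Sum.inl.inj (hu' _ h2))
        · cases hu _ h
        · obtain ⟨j', h1, h2⟩ := h
          obtain rfl := key j' h1
          cases hu' _ h2
      · refine ⟨Sum.inr (Sum.inr q), ⟨j, ht, ht'⟩, ?_⟩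
        rintro (k' | q' | q') h
        · obtain ⟨j', h1, h2⟩ := h
          obtain rfl := key j' h1
          cases hu' _ h2
        · cases hu _ h
        · obtain ⟨j', h1, h2⟩ := h
          obtain rfl := key j' h1
          rw [Sum.inr.inj (hu' _ h2)]
    · refine ⟨Sum.inr (Sum.inl q), ht, ?_⟩
      rintro (k' | q' | q') h
      · obtain ⟨j', h1, h2⟩ := h
        cases hu _ h1
      · rw [Sum.inr.inj (hu _ h)]
      · obtain ⟨j', h1, h2⟩ := h
        cases hu _ h1
  exit_pred k := by
    have key : ∀ s s' : Fin m ⊕ A.Q,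
        (∃ j, A.edge s (Sum.inl j) ∧ B.edge (Sum.inl j) (Sum.inl k)) →
        (∃ j, A.edge s' (Sum.inl j) ∧ B.edge (Sum.inl j) (Sum.inl k)) → s = s' := by
      rintro s s' ⟨j, h1, h2⟩ ⟨j', h1', h2'⟩
      obtain rfl := Sum.inl.inj (B.exit_pred k _ _ h2 h2')
      exact A.exit_pred j _ _ h1 h1'
    rintro (i | p | p) (i' | p' | p') h h'
    · rw [Sum.inl.inj (key (Sum.inl i) (Sum.inl i') h h')]
    · cases key (Sum.inl i) (Sum.inr p') h h'
    · obtain ⟨j, h1, h2⟩ := h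
      cases B.exit_pred k _ _ h2 h'
    · cases key (Sum.inr p) (Sum.inl i') h h'
    · rw [Sum.inr.inj (key (Sum.inr p) (Sum.inr p') h h')]
    · obtain ⟨j, h1, h2⟩ := h
      cases B.exit_pred k _ _ h2 h'
    · obtain ⟨j, h1, h2⟩ := h'
      cases B.exit_pred k _ _ h h2
    · obtain ⟨j, h1, h2⟩ := h'
      cases B.exit_pred k _ _ h h2
    · rw [Sum.inr.inj (B.exit_pred k _ _ h h')]
  role := Sum.elim A.role B.role
  weight := Sum.elim A.weight B.weight

/-- Juxtaposition of two games; the open ends of `A` come first. -/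
def sum {m n k l : ℕ} (A : ROMPG m n) (B : ROMPG k l) : ROMPG (m + k) (n + l) where
  Q := A.Q ⊕ B.Q
  finite_positions := by
    have := A.finite_positions
    have := B.finite_positions
    infer_instance
  edge s t :=
    (∃ a b, A.edge a b ∧
      s = a.map (Fin.castAdd k) Sum.inl ∧ t = b.map (Fin.castAdd l) Sum.inl) ∨
    (∃ a b, B.edge a b ∧
      s = a.map (Fin.natAdd m) Sum.inr ∧ t = b.map (Fin.natAdd n) Sum.inr)
  entrance_succ i := by
    refine Fin.addCases (fun i => ?_) (fun i => ?_) i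
    · obtain ⟨t, ht, hu⟩ := A.entrance_succ i
      refine ⟨t.map (Fin.castAdd l) Sum.inl, Or.inl ⟨_, t, ht, rfl, rfl⟩, ?_⟩
      rintro t' (⟨a, b, hab, ha, rfl⟩ | ⟨a, b, hab, ha, rfl⟩)
      · rcases a with i' | q
        · obtain rfl : i = i' := by simpa using ha
          rw [hu _ hab]
        · cases ha
      · rcases a with i' | q
        · have := congrArg Fin.val (Sum.inl.inj ha)
          simp at this
          omega
        · cases ha
    · obtain ⟨t, ht, hu⟩ := B.entrance_succ i
      refine ⟨t.map (Fin.natAdd n) Sum.inr, Or.inr ⟨_, t, ht, rfl, rfl⟩, ?_⟩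
      rintro t' (⟨a, b, hab, ha, rfl⟩ | ⟨a, b, hab, ha, rfl⟩)
      · rcases a with i' | q
        · have := congrArg Fin.val (Sum.inl.inj ha)
          simp at this
          omega
        · cases ha
      · rcases a with i' | q
        · obtain rfl : i = i' := by simpa using ha
          rw [hu _ hab]
        · cases ha
  exit_pred j s s' := by
    rintro (⟨a, b, hab, rfl, hb⟩ | ⟨a, b, hab, rfl, hb⟩)
      (⟨a', b', hab', rfl, hb'⟩ | ⟨a', b', hab', rfl, hb'⟩) <;>
    rcases b with b | q <;> rcases b' with b' | q' <;> cases hb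
    · obtain rfl : b = b' := by simpa using hb'
      rw [A.exit_pred _ _ _ hab hab']
    · cases hb'
    · have := congrArg Fin.val (Sum.inl.inj hb')
      simp at this
      omega
    · cases hb'
    · have := congrArg Fin.val (Sum.inl.inj hb')
      simp at this
      omega
    · cases hb'
    · obtain rfl : b = b' := by simpa using hb'
      rw [B.exit_pred _ _ _ hab hab']
    · cases hb'
  role := Sum.elim A.role B.role
  weight := Sum.elim A.weight B.weight

/-- `A.TracePath s t`: there are `k ≥ 0` and `i₁, …, iₖ` in `[l]` such that
`s → i₁ → ⋯ → iₖ → t` in `A`, where `iⱼ` is used as an exit and then as an entrance. -/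
inductive TracePath {l m n : ℕ} (A : ROMPG (l + m) (l + n)) :
    Fin (l + m) ⊕ A.Q → Fin (l + n) ⊕ A.Q → Prop
  | edge {s t} : A.edge s t → TracePath A s t
  | cons {s t} (i : Fin l) : A.edge s (Sum.inl (Fin.castAdd n i)) →
      TracePath A (Sum.inl (Fin.castAdd m i)) t → TracePath A s t

theorem TracePath.snoc_cases {l m n : ℕ} {A : ROMPG (l + m) (l + n)}
    {s : Fin (l + m) ⊕ A.Q} {t : Fin (l + n) ⊕ A.Q} (h : TracePath A s t) :
    A.edge s t ∨ ∃ i : Fin l, TracePath A s (Sum.inl (Fin.castAdd n i)) ∧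
      A.edge (Sum.inl (Fin.castAdd m i)) t := by
  induction h with
  | edge h => exact Or.inl h
  | cons i h _ ih =>
    right
    rcases ih with ih | ⟨j, h1, h2⟩
    · exact ⟨i, .edge h, ih⟩
    · exact ⟨j, .cons i h h1, h2⟩

theorem TracePath.snoc {l m n : ℕ} {A : ROMPG (l + m) (l + n)}
    {s : Fin (l + m) ⊕ A.Q} {t' t : Fin (l + n) ⊕ A.Q} (i : Fin l) (h : TracePath A s t')
    (ht' : t' = Sum.inl (Fin.castAdd n i)) (h' : A.edge (Sum.inl (Fin.castAdd m i)) t) :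
    TracePath A s t := by
  induction h with
  | edge h => subst ht'; exact .cons i h (.edge h')
  | cons j h _ ih => exact .cons j h (ih ht')

/-- The open ends that survive the trace are shifted by `l`; positions are unchanged. -/
abbrev shift (l : ℕ) {m : ℕ} {Q : Type} (s : Fin m ⊕ Q) : Fin (l + m) ⊕ Q :=
  s.map (Fin.natAdd l) id

theorem shift_injective (l : ℕ) {m : ℕ} {Q : Type} :
    Function.Injective (shift l : Fin m ⊕ Q → Fin (l + m) ⊕ Q) :=
  Sum.map_injective.2 ⟨Fin.natAdd_injective m l, Function.injective_id⟩

theorem shift_ne {l m : ℕ} {Q : Type} (s : Fin m ⊕ Q) (i : Fin l) :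
    shift l s ≠ Sum.inl (Fin.castAdd m i) := by
  rcases s with s | q
  · intro h
    have := congrArg Fin.val (Sum.inl.inj h)
    simp at this
    omega
  · simp [shift]

theorem eq_shift_or {l m : ℕ} {Q : Type} (s : Fin (l + m) ⊕ Q) :
    (∃ i : Fin l, s = Sum.inl (Fin.castAdd m i)) ∨ ∃ s' : Fin m ⊕ Q, s = shift l s' := by
  rcases s with s | q
  · refine Fin.addCases (fun i => ?_) (fun i => ?_) s
    · exact Or.inl ⟨i, rfl⟩
    · exact Or.inr ⟨Sum.inl i, rfl⟩
  · exact Or.inr ⟨Sum.inr q, rfl⟩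

theorem trace_exists {l m n : ℕ} (A : ROMPG (l + m) (l + n)) (i : Fin m) :
    ∃ t : Fin n ⊕ A.Q, TracePath A (Sum.inl (Fin.natAdd l i)) (shift l t) := by
  classical
  by_contra! hno
  choose f hf _ using A.entrance_succ
  have hcons : ∀ {s t}, A.edge s t → (∀ t', ¬ TracePath A s (shift l t')) →
      ∃ j : Fin l, t = Sum.inl (Fin.castAdd n j) ∧
        ∀ t', ¬ TracePath A (Sum.inl (Fin.castAdd m j)) (shift l t') := by
    intro s t h hs
    rcases eq_shift_or t with ⟨j, rfl⟩ | ⟨t', rfl⟩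
    · exact ⟨j, rfl, fun t' h' => hs t' (.cons j h h')⟩
    · exact absurd (.edge h) (hs t')
  -- the infinite chain of entrances in `[l]` visited from `i`
  let Bad := {j : Fin l // ∀ t', ¬ TracePath A (Sum.inl (Fin.castAdd m j)) (shift l t')}
  have hstep : ∀ b : Bad, ∃ b' : Bad, A.edge (Sum.inl (Fin.castAdd m b.1))
      (Sum.inl (Fin.castAdd n b'.1)) := by
    intro b
    obtain ⟨j, hj, hj'⟩ := hcons (hf (Fin.castAdd m b.1)) b.2
    exact ⟨⟨j, hj'⟩, hj ▸ hf (Fin.castAdd m b.1)⟩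
  choose g hg using hstep
  have ginj : Function.Injective g := by
    intro b b' h
    have h2 := hg b'
    rw [← h] at h2
    have := A.exit_pred _ _ _ (hg b) h2
    exact Subtype.ext (Fin.castAdd_injective _ _ (Sum.inl.inj this))
  obtain ⟨j, hj, hj'⟩ := hcons (hf (Fin.natAdd l i)) hno
  obtain ⟨b, hb⟩ := Finite.surjective_of_injective ginj ⟨j, hj'⟩
  have h2 := hg b
  rw [hb] at h2
  have h3 := hf (Fin.natAdd l i)
  rw [hj] at h3
  exact shift_ne (Q := A.Q) (Sum.inl i) b.1 (A.exit_pred _ _ _ h3 h2)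

theorem trace_unique {l m n : ℕ} (A : ROMPG (l + m) (l + n)) {s : Fin (l + m) ⊕ A.Q}
    {u u' : Fin (l + n) ⊕ A.Q} (h : TracePath A s u) (h' : TracePath A s u')
    (hs : ∃ i, s = Sum.inl i) (hu : ∃ t : Fin n ⊕ A.Q, u = shift l t)
    (hu' : ∃ t : Fin n ⊕ A.Q, u' = shift l t) : u = u' := by
  induction h with
  | edge h =>
    obtain ⟨i, rfl⟩ := hs
    cases h' with
    | edge h' => exact (A.entrance_succ i).unique h h'
    | cons j h' _ =>
      obtain ⟨t, rfl⟩ := hu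
      exact absurd ((A.entrance_succ i).unique h h') (shift_ne t j)
  | cons j h _ ih =>
    obtain ⟨i, rfl⟩ := hs
    cases h' with
    | edge h' =>
      obtain ⟨t, rfl⟩ := hu'
      exact absurd ((A.entrance_succ i).unique h' h) (shift_ne t j)
    | cons j' h' h2' =>
      have := (A.entrance_succ i).unique h h'
      obtain rfl := Fin.castAdd_injective _ _ (Sum.inl.inj this)
      exact ih h2' ⟨_, rfl⟩ hu

theorem trace_pred_unique {l m n : ℕ} (A : ROMPG (l + m) (l + n)) {s s' : Fin (l + m) ⊕ A.Q}
    {u : Fin (l + n) ⊕ A.Q} (h : TracePath A s u) (h' : TracePath A s' u)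
    (hu : ∃ j, u = Sum.inl j) (hs : ∃ t : Fin m ⊕ A.Q, s = shift l t)
    (hs' : ∃ t : Fin m ⊕ A.Q, s' = shift l t) : s = s' := by
  have key : ∀ {r : Fin (l + m) ⊕ A.Q} {v}, TracePath A r v → TracePath A s' v →
      (∃ j, v = Sum.inl j) → r = s' ∨ ∃ i : Fin l, r = Sum.inl (Fin.castAdd m i) ∧
        TracePath A s' (Sum.inl (Fin.castAdd n i)) := by
    intro r v h
    induction h with
    | @edge r v h =>
      rintro h' ⟨j, rfl⟩
      rcases h'.snoc_cases with h' | ⟨i, h1, h'⟩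
      · exact Or.inl (A.exit_pred j _ _ h h')
      · exact Or.inr ⟨i, A.exit_pred j _ _ h h', h1⟩
    | @cons r v i h h2 ih =>
      intro h' hv
      rcases ih h' hv with e | ⟨i', e, h3⟩
      · obtain ⟨t, rfl⟩ := hs'
        exact absurd e.symm (shift_ne t i)
      · obtain rfl := Fin.castAdd_injective _ _ (Sum.inl.inj e)
        rcases h3.snoc_cases with h3 | ⟨j, h1, h3⟩
        · exact Or.inl (A.exit_pred _ _ _ h h3)
        · exact Or.inr ⟨j, A.exit_pred _ _ _ h h3, h1⟩
  rcases key h h' hu with e | ⟨i, e, -⟩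
  · exact e
  · obtain ⟨t, rfl⟩ := hs
    exact absurd e (shift_ne t i)

/-- The trace operator: the first `l` exits are fed back into the first `l` entrances. -/
def tr {l m n : ℕ} (A : ROMPG (l + m) (l + n)) : ROMPG m n where
  Q := A.Q
  finite_positions := A.finite_positions
  edge s t := TracePath A (shift l s) (shift l t)
  entrance_succ i := by
    obtain ⟨t, ht⟩ := trace_exists A i
    refine ⟨t, ht, fun t' ht' => ?_⟩
    exact shift_injective l (trace_unique A ht' ht ⟨_, rfl⟩ ⟨_, rfl⟩ ⟨_, rfl⟩)
  exit_pred j s s' h h' :=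
    shift_injective l (trace_pred_unique A h h' ⟨_, rfl⟩ ⟨_, rfl⟩ ⟨_, rfl⟩)
  role := A.role
  weight := A.weight

/-! ### The operations respect isomorphism -/

theorem Iso.seq {m l n : ℕ} {A A' : ROMPG m l} {B B' : ROMPG l n} (hA : Iso A A')
    (hB : Iso B B') : Iso (A.seq B) (A'.seq B') := by
  obtain ⟨η, h1, h2, h3⟩ := hA
  obtain ⟨θ, k1, k2, k3⟩ := hB
  refine ⟨Equiv.sumCongr η θ, ?_, ?_, ?_⟩
  · have key : ∀ s t, seqEdge A B s t ↔
        seqEdge A' B' (s.map id (Equiv.sumCongr η θ)) (t.map id (Equiv.sumCongr η θ)) := by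
      rintro (i | p | p) (k | q | q) <;> simp [seqEdge, h1, k1]
    exact key
  · exact fun q => Sum.casesOn q h2 k2
  · exact fun q => Sum.casesOn q h3 k3

theorem Iso.sum {m n k l : ℕ} {A A' : ROMPG m n} {B B' : ROMPG k l} (hA : Iso A A')
    (hB : Iso B B') : Iso (A.sum B) (A'.sum B') := by
  have aux : ∀ {A A' : ROMPG m n} {B B' : ROMPG k l} (η : A.Q ≃ A'.Q) (θ : B.Q ≃ B'.Q)
      (_ : ∀ s t, A.edge s t ↔ A'.edge (s.map id η) (t.map id η))
      (_ : ∀ s t, B.edge s t ↔ B'.edge (s.map id θ) (t.map id θ)) (s t),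
      (A.sum B).edge s t →
        (A'.sum B').edge (s.map id (Equiv.sumCongr η θ)) (t.map id (Equiv.sumCongr η θ)) := by
    rintro A A' B B' η θ h1 k1 s t (⟨a, b, hab, rfl, rfl⟩ | ⟨a, b, hab, rfl, rfl⟩)
    · exact Or.inl ⟨_, _, (h1 _ _).1 hab, by rcases a with a | a <;> rfl,
        by rcases b with b | b <;> rfl⟩
    · exact Or.inr ⟨_, _, (k1 _ _).1 hab, by rcases a with a | a <;> rfl,
        by rcases b with b | b <;> rfl⟩
  obtain ⟨η, h1, h2, h3⟩ := hA
  obtain ⟨θ, k1, k2, k3⟩ := hB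
  refine ⟨Equiv.sumCongr η θ, fun s t => ⟨aux η θ h1 k1 s t, fun h => ?_⟩, ?_, ?_⟩
  · have := aux η.symm θ.symm (fun s t => by rw [h1]; simp) (fun s t => by rw [k1]; simp) _ _ h
    have e : ∀ {p : ℕ} (s : Fin p ⊕ (A.Q ⊕ B.Q)), (s.map id (Equiv.sumCongr η θ)).map id
        (Equiv.sumCongr η.symm θ.symm) = s := by
      rintro p (s | s | s) <;> simp
    exact Eq.mp (congrArg₂ (A.sum B).edge (e s) (e t)) this
  · exact fun q => Sum.casesOn q h2 k2
  · exact fun q => Sum.casesOn q h3 k3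

theorem Iso.tr {l m n : ℕ} {A A' : ROMPG (l + m) (l + n)} (hA : Iso A A') :
    Iso A.tr A'.tr := by
  have aux : ∀ {A A' : ROMPG (l + m) (l + n)} (η : A.Q ≃ A'.Q)
      (_ : ∀ s t, A.edge s t ↔ A'.edge (s.map id η) (t.map id η)) (s t),
      TracePath A s t → TracePath A' (s.map id η) (t.map id η) := by
    intro A A' η h1 s t h
    induction h with
    | edge h => exact .edge ((h1 _ _).1 h)
    | cons i h _ ih => exact .cons i ((h1 _ _).1 h) ih
  obtain ⟨η, h1, h2, h3⟩ := hA
  refine ⟨η, fun s t => ⟨fun h => ?_, fun h => ?_⟩, h2, h3⟩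
  · have := aux η h1 _ _ h
    rcases s with s | s <;> rcases t with t | t <;> exact this
  · have := aux η.symm (fun s t => by rw [h1]; simp) _ _ h
    have e : ∀ {p : ℕ} (s : Fin p ⊕ A.Q),
        (shift l (s.map id η)).map id η.symm = shift l s := by
      rintro p (s | s) <;> simp
    exact Eq.mp (congrArg₂ (TracePath A) (e s) (e t)) this

end ROMPG

/-! ### Arrows of the category of rightward open games: isomorphism classes -/

/-- Isomorphism classes of rightward open mean payoff games from `m` to `n`. -/
def ROHom (m n : ℕ) : Type 1 := Quotient (ROMPG.setoid m n)

namespace ROHom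

/-- Wires: see `ROMPG.wires`. -/
def wires {m n : ℕ} (e : Fin m ≃ Fin n) : ROHom m n := Quotient.mk _ (ROMPG.wires e)

/-- The identity on `m`. -/
def id (m : ℕ) : ROHom m m := wires (Equiv.refl _)

/-- The swap `σ`: entrance `i ≤ m` goes to exit `n + i`, entrance `m + j` goes to exit `j`. -/
def swap (m n : ℕ) : ROHom (m + n) (n + m) := wires finAddFlip

/-- Sequential composition. -/
def seq {m l n : ℕ} (A : ROHom m l) (B : ROHom l n) : ROHom m n :=
  Quotient.map₂ ROMPG.seq (fun _ _ hA _ _ hB => ROMPG.Iso.seq hA hB) A B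

/-- Sum. -/
def sum {m n k l : ℕ} (A : ROHom m n) (B : ROHom k l) : ROHom (m + k) (n + l) :=
  Quotient.map₂ ROMPG.sum (fun _ _ hA _ _ hB => ROMPG.Iso.sum hA hB) A B

/-- Trace. -/
def tr (l : ℕ) {m n : ℕ} (A : ROHom (l + m) (l + n)) : ROHom m n :=
  Quotient.map ROMPG.tr (fun _ _ hA => ROMPG.Iso.tr hA) A

/-- Transport along equalities of natural numbers (associativity and unit laws of `+`). -/
def cast {m n m' n' : ℕ} (hm : m = m') (hn : n = n') (A : ROHom m n) : ROHom m' n' :=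
  hm ▸ hn ▸ A

end ROHom

/-! ### Open mean payoff games: the `Int` construction -/

/-- Objects: pairs of natural numbers, the number of rightward and of leftward open ends. -/
@[ext]
structure OMPG : Type where
  right : ℕ
  left : ℕ

namespace OMPG

/-- An arrow `(m_r, m_l) ⟶ (n_r, n_l)` is an arrow `m_r + n_l ⟶ n_r + m_l` between
rightward arities. -/
abbrev Arrow (m n : OMPG) : Type 1 := ROHom (m.right + n.left) (n.right + m.left)

/-- Identity. -/
def id (m : OMPG) : Arrow m m := ROHom.id (m.right + m.left)

open ROHom in
/-- Sequential composition:
`tr_{l_l} ((σ_{l_l, m_r} ⊕ id_{n_l}) ; (A ⊕ id_{n_l}) ; (id_{l_r} ⊕ σ_{m_l, n_l}) ;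
  (B ⊕ id_{m_l}) ; (σ_{n_r, l_l} ⊕ id_{m_l}))`. -/
def comp {m l n : OMPG} (A : Arrow m l) (B : Arrow l n) : Arrow m n :=
  tr l.left
    (ROHom.cast (Nat.add_assoc _ _ _) (Nat.add_assoc _ _ _)
      (((((ROHom.sum (swap l.left m.right) (ROHom.id n.left)).seq
        (ROHom.sum A (ROHom.id n.left))).seq
        (ROHom.cast (Nat.add_assoc _ _ _).symm (Nat.add_assoc _ _ _).symm
          (ROHom.sum (ROHom.id l.right) (swap m.left n.left)))).seq
        (ROHom.sum B (ROHom.id m.left))).seq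
        (ROHom.sum (swap n.right l.left) (ROHom.id m.left))))

instance : CategoryStruct.{1} OMPG where
  Hom := Arrow
  id := id
  comp := comp

/-- Sum of objects: `(m_r, m_l) ⊕ (k_r, k_l) = (m_r + k_r, k_l + m_l)`. -/
def sumObj (m k : OMPG) : OMPG := ⟨m.right + k.right, k.left + m.left⟩

/-- The unit object. -/
def unit : OMPG := ⟨0, 0⟩

open ROHom in
/-- Sum of arrows:
`(σ_{m_r, k_r} ⊕ σ_{l_l, n_l}) ; (id_{k_r} ⊕ A ⊕ id_{l_l}) ; (σ_{k_r, n_r} ⊕ σ_{m_l, l_l}) ;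
  (id_{n_r} ⊕ B ⊕ id_{m_l})`. -/
def sumHom {m n k l : OMPG} (A : m ⟶ n) (B : k ⟶ l) : sumObj m k ⟶ sumObj n l :=
  (((ROHom.sum (swap m.right k.right) (swap l.left n.left)).seq
    (ROHom.cast (by omega) (by omega)
      (ROHom.sum (ROHom.sum (ROHom.id k.right) A) (ROHom.id l.left)))).seq
    (ROHom.sum (swap k.right n.right) (swap m.left l.left))).seq
    (ROHom.cast (by omega) (by simp only [sumObj]; omega)
      (ROHom.sum (ROHom.sum (ROHom.id n.right) B) (ROHom.id m.left)))

/-- The symmetry: rightward wires are swapped and leftward wires are swapped. -/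
def swapHom (m k : OMPG) : sumObj m k ⟶ sumObj k m :=
  ROHom.sum (ROHom.swap m.right k.right) (ROHom.swap m.left k.left)

/-- The dual of `(m_r, m_l)` is `(m_l, m_r)`. -/
def dual (m : OMPG) : OMPG := ⟨m.left, m.right⟩

/-- The unit `d` of the duality, `(0, 0) ⟶ m ⊕ m*`: wires that turn around. -/
def coev (m : OMPG) : unit ⟶ sumObj m (dual m) :=
  ROHom.cast (by simp [unit, sumObj, dual]) (by simp [unit, sumObj, dual])
    (ROHom.id (m.right + m.left))

/-- The counit `e` of the duality, `m* ⊕ m ⟶ (0, 0)`: wires that turn around. -/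
def ev (m : OMPG) : sumObj (dual m) m ⟶ unit :=
  ROHom.cast (by simp [unit, sumObj, dual]) (by simp [unit, sumObj, dual])
    (ROHom.id (m.left + m.right))

end OMPG

/-! ### Compact closed categories -/

/-- The axioms of a category, for given arrows, identities and composition. -/
structure CategoryAxioms (C : Type u) [CategoryStruct.{v} C] : Prop where
  id_comp : ∀ {X Y : C} (f : X ⟶ Y), 𝟙 X ≫ f = f
  comp_id : ∀ {X Y : C} (f : X ⟶ Y), f ≫ 𝟙 Y = f
  assoc : ∀ {W X Y Z : C} (f : W ⟶ X) (g : X ⟶ Y) (h : Y ⟶ Z), (f ≫ g) ≫ h = f ≫ g ≫ h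

/-- The category with the given arrows, identities and composition. -/
abbrev CategoryAxioms.category {C : Type u} [CategoryStruct.{v} C] (h : CategoryAxioms C) :
    Category.{v} C where
  id_comp := h.id_comp
  comp_id := h.comp_id
  assoc := h.assoc

/-- A compact closed category: a symmetric monoidal category in which every object `X` has a
(chosen) dual `dual X`, with unit `𝟙_ C ⟶ X ⊗ dual X` and counit `dual X ⊗ X ⟶ 𝟙_ C` subject to
the triangle identities. -/
class CompactClosedCategory (C : Type u) [Category.{v} C] [MonoidalCategory C] extends
    SymmetricCategory C where
  dual : C → C
  exactPairing : ∀ X : C, ExactPairing X (dual X)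

/-! Every operation on games juxtaposes graphs, links some exits to some entrances and hides the
linked ends, or renames open ends. The equations to be proved need neither ends in `Fin n` nor the
uniqueness conditions on edges. So `Net α β` allows ends in arbitrary types and arbitrary edges, and
the single operation `close` adds a family of hidden links and relabels what remains; an edge of the
closed game is a `Run`, a path through hidden links.

Expressions in these operations have a normal form, one `close` applied to one `sum`. Links added in
stages can be added at once (`Run.nested`, `NetClass.close_close`), closing commutes with
juxtaposition (`Run.liftRel_iff`, `NetClass.sum_close_close`), and identity wires adjacent to hidden
links can be contracted (`Run.contract`, `NetClass.close_sum_wires`). The last fact makes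
composition with wires a mere relabelling.

With these rules, games between interfaces form a compact closed category `Iface`. Associativity and
interchange compare two normal forms that differ only in the names of the links, coherence compares
bijections of ends, and the triangle identities follow each end through the turning wires.

Open mean payoff games embed into `Iface`. In the formulas for composition and sum all games except
the two arguments are wires; contracting them shows that `toArrow` carries these formulas to the
operations of `Iface` (`OMPG.toArrow_comp`, `OMPG.toArrow_sumHom`). Since `toArrow` is injective,
all axioms are reflected. The objects of a sum are compared by the bijections `Fin a ⊕ Fin b ≃ Fin
(a + b)`, composed with a swap for leftward ends, and under them the equality casts of the strict
structure become the structure maps of `Iface`. -/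

/-! ### Paths through hidden links -/

/-- `Run R x y s t`: there is a path from `s` to `t` that alternates between edges of `R` and hidden
links, the link `h` leading from the target `x h` to the source `y h`. -/
inductive Run {S T H : Type*} (R : S → T → Prop) (x : H → T) (y : H → S) : S → T → Prop
  | edge {s t} : R s t → Run R x y s t
  | step {s t} (h : H) : R s (x h) → Run R x y (y h) t → Run R x y s t

namespace Run

variable {S T S' T' H H' : Type*} {R : S → T → Prop} {R' : S' → T' → Prop} {x : H → T} {y : H → S}
  {x' : H' → T'} {y' : H' → S'}

/-- Concatenation of runs across a link; the constructor `step` allows only a single edge in front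
of the link. -/
theorem link {s t} (h : H) (h₁ : Run R x y s (x h)) (h₂ : Run R x y (y h) t) : Run R x y s t := by
  generalize hu : x h = u at h₁
  induction h₁ with
  | edge hr => subst hu; exact .step h hr h₂
  | step k hr _ ih => exact .step k hr (ih hu)

theorem map (f : S → S') (g : T → T') (k : H → H') (hR : ∀ s t, R s t → R' (f s) (g t))
    (hx : ∀ h, g (x h) = x' (k h)) (hy : ∀ h, f (y h) = y' (k h)) {s t} (h : Run R x y s t) :
    Run R' x' y' (f s) (g t) := by
  induction h with
  | edge hr => exact .edge (hR _ _ hr)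
  | step h hr _ ih => exact .step (k h) (hx h ▸ hR _ _ hr) (hy h ▸ ih)

theorem equiv_iff (f : S ≃ S') (g : T ≃ T') (k : H ≃ H') (hR : ∀ s t, R s t ↔ R' (f s) (g t))
    (hx : ∀ h, g (x h) = x' (k h)) (hy : ∀ h, f (y h) = y' (k h)) {s t} :
    Run R x y s t ↔ Run R' x' y' (f s) (g t) := by
  refine ⟨map f g k (fun s t => (hR s t).1) hx hy, fun h => ?_⟩
  have := map (R' := R) (x' := x) (y' := y) f.symm g.symm k.symm
    (fun s t h => (hR _ _).2 (by simpa using h)) (fun h => by simp [Equiv.symm_apply_eq, hx])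
    (fun h => by simp [Equiv.symm_apply_eq, hy]) h
  simpa using this

theorem of_isEmpty [IsEmpty H] {s t} : Run R x y s t ↔ R s t := by
  refine ⟨fun h => ?_, .edge⟩
  cases h with
  | edge h => exact h
  | step h => exact isEmptyElim h

/-- Cutting a run at its outer links leaves segments that use inner links only, and these segments
are the edges of the nested relation. -/
theorem nested (i : S' → S) (o : T' → T) (x' : H' → T') (y' : H' → S') {s t} :
    Run (fun s t => Run R x y (i s) (o t)) x' y' s t ↔
      Run R (Sum.elim x (o ∘ x')) (Sum.elim y (i ∘ y')) (i s) (o t) := by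
  have emb : ∀ {s t}, Run R x y s t → Run R (Sum.elim x (o ∘ x')) (Sum.elim y (i ∘ y')) s t :=
    fun h => map (R' := R) (x' := Sum.elim x (o ∘ x')) (y' := Sum.elim y (i ∘ y')) id id Sum.inl
      (fun _ _ h => h) (fun _ => rfl) (fun _ => rfl) h
  constructor
  · intro h
    induction h with
    | edge h => exact emb h
    | step h h₁ _ ih => exact link (Sum.inr h) (emb h₁) ih
  -- The source `s₀` must be arbitrary: after an inner link the run continues at some `y h`, which
  -- need not lie in the image of `i`. The nested relation is therefore used only from the first
  -- outer link on.
  · have key : ∀ {s₀ t₀}, Run R (Sum.elim x (o ∘ x')) (Sum.elim y (i ∘ y')) s₀ t₀ → t₀ = o t →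
        Run R x y s₀ (o t) ∨ ∃ h, Run R x y s₀ (o (x' h)) ∧
          Run (fun s t => Run R x y (i s) (o t)) x' y' (y' h) t := by
      intro s₀ t₀ h
      induction h with
      | edge h => rintro rfl; exact Or.inl (.edge h)
      | step h hr _ ih =>
        intro e
        rcases h with h | h
        · rcases ih e with h₁ | ⟨k, h₁, h₂⟩
          · exact Or.inl (.step h hr h₁)
          · exact Or.inr ⟨k, .step h hr h₁, h₂⟩
        · refine Or.inr ⟨h, .edge hr, ?_⟩
          rcases ih e with h₁ | ⟨k, h₁, h₂⟩
          · exact .edge h₁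
          · exact .step k h₁ h₂
    intro h
    rcases key h rfl with h₁ | ⟨k, h₁, h₂⟩
    · exact .edge h₁
    · exact .step k h₁ h₂

/-- Edges and links stay within one summand, hence so does every run. -/
theorem liftRel_iff {s : S ⊕ S'} {t : T ⊕ T'} :
    Run (Sum.LiftRel R R') (Sum.map x x') (Sum.map y y') s t ↔
      Sum.LiftRel (Run R x y) (Run R' x' y') s t := by
  constructor
  · intro h
    induction h with
    | edge h => exact h.mono (fun _ _ => .edge) (fun _ _ => .edge)
    | step h hr _ ih =>
      rcases h with h | h <;> cases hr <;> cases ih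
      · exact .inl (.step h ‹_› ‹_›)
      · exact .inr (.step h ‹_› ‹_›)
  · rintro (h | h)
    · exact map (R' := Sum.LiftRel R R') (x' := Sum.map x x') (y' := Sum.map y y')
        Sum.inl Sum.inl Sum.inl (fun _ _ => .inl) (fun _ => rfl) (fun _ => rfl) h
    · exact map (R' := Sum.LiftRel R R') (x' := Sum.map x x') (y' := Sum.map y y')
        Sum.inr Sum.inr Sum.inr (fun _ _ => .inr) (fun _ => rfl) (fun _ => rfl) h

/-- Contraction of identity wires. The wires in `V` are always followed by a link to `c v`, the
wires in `W` are always preceded by a link from `d w`. -/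
theorem contract {V W : Type*} {X : H' → T ⊕ (V ⊕ W)} {Y : H' → S ⊕ (V ⊕ W)}
    {c : V → S} {d : W → T}
    (hH : ∀ k, (∃ h, X k = .inl (x h) ∧ Y k = .inl (y h)) ∨
      (∃ v, X k = .inr (.inl v) ∧ Y k = .inl (c v)) ∨
      (∃ w, X k = .inl (d w) ∧ Y k = .inr (.inr w)))
    (hx : ∀ h, ∃ k, X k = .inl (x h) ∧ Y k = .inl (y h))
    (hc : ∀ v, ∃ k, X k = .inr (.inl v) ∧ Y k = .inl (c v))
    (hd : ∀ w, ∃ k, X k = .inl (d w) ∧ Y k = .inr (.inr w))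
    {s a t b} (hs : s = .inl a ∨ ∃ v, s = .inr (.inl v) ∧ a = c v)
    (ht : t = .inl b ∨ ∃ w, t = .inr (.inr w) ∧ b = d w) :
    Run (Sum.LiftRel R (· = ·)) X Y s t ↔ Run R x y a b := by
  constructor
  · intro h
    -- The induction needs a second clause for runs that start on a wire of `W`. Such a wire leads
    -- to a target from which no link departs, so the run ends there and `b` is the place `d w` from
    -- which the wire was entered.
    have key : (∀ a, (s = .inl a ∨ ∃ v, s = .inr (.inl v) ∧ a = c v) → Run R x y a b) ∧
        ∀ w, s = .inr (.inr w) → b = d w := by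
      clear hs
      induction h with
      | edge h =>
        rcases h with h | h
        · rcases ht with ht | ⟨w, ht, -⟩
          · cases ht
            refine ⟨?_, nofun⟩
            rintro a (e | ⟨v, e, -⟩) <;> cases e
            exact .edge h
          · cases ht
        · subst h
          rcases ht with ht | ⟨w, ht, rfl⟩
          · cases ht
          · cases ht
            refine ⟨?_, ?_⟩
            · rintro a (e | ⟨v, e, -⟩) <;> cases e
            · rintro w e; cases e; rfl
      | step k hr _ ih =>
        obtain ⟨ih₁, ih₂⟩ := ih ht
        rcases hH k with ⟨h, e, e'⟩ | ⟨v, e, e'⟩ | ⟨w, e, e'⟩ <;> rw [e] at hr <;>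
          rw [e'] at ih₁ ih₂ <;> cases hr
        · refine ⟨?_, nofun⟩
          rintro a (e | ⟨v, e, -⟩) <;> cases e
          exact .step h ‹_› (ih₁ _ (.inl rfl))
        · rename_i e
          subst e
          refine ⟨?_, nofun⟩
          rintro a (e | ⟨v, e, rfl⟩) <;> cases e
          exact ih₁ _ (.inl rfl)
        · refine ⟨?_, nofun⟩
          rintro a (e | ⟨v, e, -⟩) <;> cases e
          -- The link enters a wire of `W`, where the run ends; the edge just used already leads to
          -- `b`.
          rw [ih₂ w rfl]
          exact .edge ‹_›
    exact key.1 a hs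
  · intro h
    have key : Run (Sum.LiftRel R (· = ·)) X Y (.inl a) t := by
      clear hs
      induction h with
      | edge h =>
        rcases ht with rfl | ⟨w, rfl, rfl⟩
        · exact .edge (.inl h)
        · obtain ⟨k, e, e'⟩ := hd w
          refine .step k (e ▸ .inl h) (e' ▸ .edge (.inr rfl))
      | step h hr _ ih =>
        obtain ⟨k, e, e'⟩ := hx h
        exact .step k (e ▸ .inl hr) (e' ▸ ih ht)
    rcases hs with rfl | ⟨v, rfl, rfl⟩
    · exact key
    · obtain ⟨k, e, e'⟩ := hc v
      exact .step k (e ▸ .inr rfl) (e' ▸ key)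

/-- A deterministic walk has no choice of edge, and injectivity of `x` leaves no choice of link. It
can stop only where no link departs. -/
theorem unique (hR : ∀ s t t', R s t → R s t' → t = t') (hx : Function.Injective x) {s t t'}
    (h : Run R x y s t) (h' : Run R x y s t') (ht : ∀ h, x h ≠ t) (ht' : ∀ h, x h ≠ t') :
    t = t' := by
  induction h with
  | edge h =>
    cases h' with
    | edge h' => exact hR _ _ _ h h'
    | step k h' _ => exact absurd (hR _ _ _ h' h) (ht k)
  | step k h _ ih =>
    cases h' with
    | edge h' => exact absurd (hR _ _ _ h h') (ht' k)
    | step k' h' h₂ =>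
      obtain rfl := hx (hR _ _ _ h h')
      exact ih h₂ ht

end Run

/-! ### Games with arbitrary open ends -/

/-- A game whose entrances are the elements of `α` and whose exits are the elements of `β`, without
conditions on the edges. -/
structure Net (α β : Type) : Type 1 where
  /-- positions -/
  Q : Type
  edge : α ⊕ Q → β ⊕ Q → Prop
  role : Q → Role
  weight : Q → ℝ

namespace Net

variable {α β γ δ α' β' γ' δ' H H' : Type}

/-- Isomorphism of games. -/
def Iso (A B : Net α β) : Prop :=
  ∃ η : A.Q ≃ B.Q,
    (∀ s t, A.edge s t ↔ B.edge (s.map id η) (t.map id η)) ∧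
    (∀ q, A.role q = B.role (η q)) ∧
    (∀ q, A.weight q = B.weight (η q))

theorem Iso.mk {Q Q' : Type} {E : α ⊕ Q → β ⊕ Q → Prop} {E' : α ⊕ Q' → β ⊕ Q' → Prop}
    {r : Q → Role} {r' : Q' → Role} {w : Q → ℝ} {w' : Q' → ℝ} (η : Q ≃ Q')
    (hE : ∀ s t, E s t ↔ E' (s.map id η) (t.map id η)) (hr : ∀ q, r q = r' (η q))
    (hw : ∀ q, w q = w' (η q)) : Iso ⟨Q, E, r, w⟩ ⟨Q', E', r', w'⟩ :=
  ⟨η, hE, hr, hw⟩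

instance setoid (α β : Type) : Setoid (Net α β) where
  r := Iso
  iseqv :=
    { refl := fun A => ⟨Equiv.refl _, by simp, by simp, by simp⟩
      symm := by
        rintro A B ⟨η, h1, h2, h3⟩
        refine ⟨η.symm, fun s t => ?_, fun q => ?_, fun q => ?_⟩
        · rw [h1]; simp
        · rw [h2]; simp
        · rw [h3]; simp
      trans := by
        rintro A B C ⟨η, h1, h2, h3⟩ ⟨θ, k1, k2, k3⟩
        refine ⟨η.trans θ, fun s t => ?_, fun q => ?_, fun q => ?_⟩
        · rw [h1, k1]; simp [Sum.map_map, Equiv.coe_trans]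
        · rw [h2, k2]; simp
        · rw [h3, k3]; simp }

/-- The game without positions that connects entrance `a` to exit `f a`. -/
def wires (f : α → β) : Net α β where
  Q := Empty
  edge s t := s.map f id = t
  role q := q.elim
  weight q := q.elim

/-- The ends and positions of a juxtaposition belong to one of the two components. -/
def splitPorts {P Q : Type} : (α ⊕ β) ⊕ (P ⊕ Q) ≃ (α ⊕ P) ⊕ (β ⊕ Q) where
  toFun
    | .inl (.inl a) => .inl (.inl a)
    | .inl (.inr b) => .inr (.inl b)
    | .inr (.inl p) => .inl (.inr p)
    | .inr (.inr q) => .inr (.inr q)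
  invFun
    | .inl (.inl a) => .inl (.inl a)
    | .inl (.inr p) => .inr (.inl p)
    | .inr (.inl b) => .inl (.inr b)
    | .inr (.inr q) => .inr (.inr q)
  left_inv := by rintro ((_ | _) | (_ | _)) <;> rfl
  right_inv := by rintro ((_ | _) | (_ | _)) <;> rfl

/-- `splitPorts` for a second component without positions. -/
def splitPortsEmpty {P : Type} : (α ⊕ β) ⊕ (P ⊕ Empty) ≃ (α ⊕ P) ⊕ β where
  toFun
    | .inl (.inl a) => .inl (.inl a)
    | .inl (.inr b) => .inr b
    | .inr (.inl p) => .inl (.inr p)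
  invFun
    | .inl (.inl a) => .inl (.inl a)
    | .inl (.inr p) => .inr (.inl p)
    | .inr b => .inl (.inr b)
  left_inv := by rintro ((_ | _) | (_ | ⟨⟨⟩⟩)) <;> rfl
  right_inv := by rintro ((_ | _) | _) <;> rfl

/-- Edges of a juxtaposition. -/
def sumEdge (A : Net α β) (B : Net α' β') :
    (α ⊕ α') ⊕ (A.Q ⊕ B.Q) → (β ⊕ β') ⊕ (A.Q ⊕ B.Q) → Prop
  | .inl (.inl a), .inl (.inl b) => A.edge (.inl a) (.inl b)
  | .inl (.inl a), .inr (.inl q) => A.edge (.inl a) (.inr q)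
  | .inr (.inl p), .inl (.inl b) => A.edge (.inr p) (.inl b)
  | .inr (.inl p), .inr (.inl q) => A.edge (.inr p) (.inr q)
  | .inl (.inr a), .inl (.inr b) => B.edge (.inl a) (.inl b)
  | .inl (.inr a), .inr (.inr q) => B.edge (.inl a) (.inr q)
  | .inr (.inr p), .inl (.inr b) => B.edge (.inr p) (.inl b)
  | .inr (.inr p), .inr (.inr q) => B.edge (.inr p) (.inr q)
  | _, _ => False

/-- This is the form to which the lemmas on runs apply. The definition of `sumEdge` by cases instead
makes symmetry and associativity of juxtaposition hold by `Iff.rfl`. -/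
theorem sumEdge_iff {A : Net α β} {B : Net α' β'} {s t} :
    sumEdge A B s t ↔ Sum.LiftRel A.edge B.edge (splitPorts s) (splitPorts t) := by
  rcases s with (s | s) | (s | s) <;> rcases t with (t | t) | (t | t) <;>
    simp [sumEdge, splitPorts]

/-- Juxtaposition. -/
def sum (A : Net α β) (B : Net α' β') : Net (α ⊕ α') (β ⊕ β') where
  Q := A.Q ⊕ B.Q
  edge := sumEdge A B
  role := Sum.elim A.role B.role
  weight := Sum.elim A.weight B.weight

/-- Feedback and relabelling: for every `h : H` the exit `x h` is connected to the entrance `y h`;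
afterwards the entrances `i c` and the exits `o d` are kept. -/
def close (x : H → β) (y : H → α) (i : γ → α) (o : δ → β) (A : Net α β) : Net γ δ where
  Q := A.Q
  edge s t := Run A.edge (Sum.inl ∘ x) (Sum.inl ∘ y) (s.map i id) (t.map o id)
  role := A.role
  weight := A.weight

/-- Relabelling of the open ends. -/
def reindex (i : γ → α) (o : δ → β) (A : Net α β) : Net γ δ where
  Q := A.Q
  edge s t := A.edge (s.map i id) (t.map o id)
  role := A.role
  weight := A.weight

theorem Iso.sum {A B : Net α β} {A' B' : Net α' β'} (h : Iso A B) (h' : Iso A' B') :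
    Iso (A.sum A') (B.sum B') := by
  obtain ⟨η, h1, h2, h3⟩ := h
  obtain ⟨θ, k1, k2, k3⟩ := h'
  refine .mk (Equiv.sumCongr η θ) ?_ ?_ ?_
  ·    rintro ((s | s) | (s | s)) ((t | t) | (t | t)) <;>
    first
    | exact h1 _ _
    | exact k1 _ _
    | exact Iff.rfl
  · exact fun q => Sum.casesOn q h2 k2
  · exact fun q => Sum.casesOn q h3 k3

theorem Iso.close {A B : Net α β} (h : Iso A B) (x : H → β) (y : H → α) (i : γ → α) (o : δ → β) :
    Iso (A.close x y i o) (B.close x y i o) := by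
  obtain ⟨η, h1, h2, h3⟩ := h
  refine ⟨η, fun s t => ?_, h2, h3⟩
  refine (Run.equiv_iff (R' := B.edge) (x' := Sum.inl ∘ x) (y' := Sum.inl ∘ y)
    (Equiv.sumCongr (Equiv.refl _) η) (Equiv.sumCongr (Equiv.refl _) η)
    (Equiv.refl _) h1 (fun _ => rfl) (fun _ => rfl)).trans ?_
  rcases s with s | s <;> rcases t with t | t <;> rfl

theorem Iso.reindex {A B : Net α β} (h : Iso A B) (i : γ → α) (o : δ → β) :
    Iso (A.reindex i o) (B.reindex i o) := by
  obtain ⟨η, h1, h2, h3⟩ := h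
  refine ⟨η, fun s t => ?_, h2, h3⟩
  refine (h1 _ _).trans ?_
  rcases s with s | s <;> rcases t with t | t <;> rfl

end Net

/-- Isomorphism classes of games with open ends in arbitrary types. -/
def NetClass (α β : Type) : Type 1 := Quotient (Net.setoid α β)

namespace NetClass

variable {α β γ δ α' β' γ' δ' ε ζ H H' : Type}

/-- See `Net.wires`. -/
def wires (f : α → β) : NetClass α β := Quotient.mk _ (Net.wires f)

/-- See `Net.sum`. -/
def sum (A : NetClass α β) (B : NetClass α' β') : NetClass (α ⊕ α') (β ⊕ β') :=
  Quotient.map₂ Net.sum (fun _ _ h _ _ h' => Net.Iso.sum h h') A B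

/-- See `Net.close`. -/
def close (x : H → β) (y : H → α) (i : γ → α) (o : δ → β) (A : NetClass α β) : NetClass γ δ :=
  Quotient.map (Net.close x y i o) (fun _ _ h => Net.Iso.close h x y i o) A

/-- See `Net.reindex`. -/
def reindex (i : γ → α) (o : δ → β) (A : NetClass α β) : NetClass γ δ :=
  Quotient.map (Net.reindex i o) (fun _ _ h => Net.Iso.reindex h i o) A

/-! ### Calculus of closing, relabelling and juxtaposition -/

theorem reindex_id (A : NetClass α β) : reindex id id A = A := by
  induction A using Quotient.inductionOn with | _ A
  exact congrArg (Quotient.mk _) (by simp [Net.reindex])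

theorem reindex_reindex (i : γ → α) (o : δ → β) (i' : γ' → γ) (o' : δ' → δ) (A : NetClass α β) :
    reindex i' o' (reindex i o A) = reindex (i ∘ i') (o ∘ o') A := by
  induction A using Quotient.inductionOn with | _ A
  exact congrArg (Quotient.mk _) (by simp [Net.reindex])

theorem reindex_close (x : H → β) (y : H → α) (i : γ → α) (o : δ → β) (i' : γ' → γ) (o' : δ' → δ)
    (A : NetClass α β) : reindex i' o' (close x y i o A) = close x y (i ∘ i') (o ∘ o') A := by
  induction A using Quotient.inductionOn with | _ A
  exact congrArg (Quotient.mk _) (by simp [Net.reindex, Net.close])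

/-- Read from right to left with `H := Empty`, this derives the laws of relabelling from those of
closing. -/
theorem close_eq_reindex [IsEmpty H] (x : H → β) (y : H → α) (i : γ → α) (o : δ → β)
    (A : NetClass α β) : close x y i o A = reindex i o A := by
  induction A using Quotient.inductionOn with | _ A
  exact congrArg (Quotient.mk _) (by simp [Net.reindex, Net.close, Run.of_isEmpty])

/-- Links may be renamed. -/
theorem close_congr (e : H ≃ H') {x : H → β} {y : H → α} {i : γ → α} {o : δ → β}
    {x' : H' → β} {y' : H' → α} {i' : γ → α} {o' : δ → β} (hx : ∀ h, x h = x' (e h))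
    (hy : ∀ h, y h = y' (e h)) (hi : ∀ c, i c = i' c) (ho : ∀ d, o d = o' d) (A : NetClass α β) :
    close x y i o A = close x' y' i' o' A := by
  obtain rfl : i = i' := funext hi
  obtain rfl : o = o' := funext ho
  induction A using Quotient.inductionOn with | _ A
  refine congrArg (Quotient.mk _) ?_
  simp only [Net.close, Net.mk.injEq, heq_eq_eq, true_and, and_true]
  ext s t
  exact Run.equiv_iff (R' := A.edge) (x' := Sum.inl ∘ x') (y' := Sum.inl ∘ y') (.refl _) (.refl _) e
    (fun _ _ => Iff.rfl) (fun h => by simp [hx]) (fun h => by simp [hy])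

/-- The vanishing law, from `Run.nested`: the outer links are attached to ends that survive the
inner closing, so `o` and `i` translate them to ends of `A`. -/
theorem close_close (x : H → β) (y : H → α) (i : γ → α) (o : δ → β)
    (x' : H' → δ) (y' : H' → γ) (i' : γ' → γ) (o' : δ' → δ) (A : NetClass α β) :
    close x' y' i' o' (close x y i o A) =
      close (Sum.elim x (o ∘ x')) (Sum.elim y (i ∘ y')) (i ∘ i') (o ∘ o') A := by
  induction A using Quotient.inductionOn with | _ A
  refine congrArg (Quotient.mk _) ?_
  simp only [Net.close, Net.mk.injEq, heq_eq_eq, true_and, and_true]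
  ext s t
  refine (Run.nested (Sum.map i id) (Sum.map o id) _ _).trans ?_
  refine Iff.trans (Run.equiv_iff (R' := A.edge) (x' := Sum.inl ∘ Sum.elim x (o ∘ x'))
    (y' := Sum.inl ∘ Sum.elim y (i ∘ y')) (.refl _) (.refl _) (.refl _) (fun _ _ => Iff.rfl)
    ?_ ?_) ?_
  · rintro (h | h) <;> rfl
  · rintro (h | h) <;> rfl
  · simp

theorem close_reindex (i : γ → α) (o : δ → β)
    (x' : H' → δ) (y' : H' → γ) (i' : γ' → γ) (o' : δ' → δ) (A : NetClass α β) :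
    close x' y' i' o' (reindex i o A) = close (o ∘ x') (i ∘ y') (i ∘ i') (o ∘ o') A := by
  rw [← close_eq_reindex (H := Empty) Empty.elim Empty.elim, close_close]
  exact close_congr (Equiv.emptySum _ _) (by rintro (⟨⟨⟩⟩ | h); rfl) (by rintro (⟨⟨⟩⟩ | h); rfl)
    (fun _ => rfl) (fun _ => rfl) A

/-- The superposing law, from `Run.liftRel_iff` once the ends and positions are sorted by component.
-/
theorem sum_close_close (x : H → β) (y : H → α) (i : γ → α) (o : δ → β)
    (x' : H' → β') (y' : H' → α') (i' : γ' → α') (o' : δ' → β') (A : NetClass α β)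
    (B : NetClass α' β') :
    sum (close x y i o A) (close x' y' i' o' B) =
      close (Sum.map x x') (Sum.map y y') (Sum.map i i') (Sum.map o o') (sum A B) := by
  induction A using Quotient.inductionOn with | _ A
  induction B using Quotient.inductionOn with | _ B
  refine Quotient.sound (.mk (.refl (A.Q ⊕ B.Q)) (fun s t => ?_) (fun _ => rfl) (fun _ => rfl))
  symm
  refine (Run.equiv_iff (R' := Sum.LiftRel A.edge B.edge)
    (x' := Sum.map (Sum.inl ∘ x) (Sum.inl ∘ x')) (y' := Sum.map (Sum.inl ∘ y) (Sum.inl ∘ y'))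
    Net.splitPorts Net.splitPorts (.refl _) (fun _ _ => Net.sumEdge_iff) ?_ ?_).trans
    (Run.liftRel_iff.trans ?_)
  · rintro (h | h) <;> rfl
  · rintro (h | h) <;> rfl
  · rcases s with (s | s) | (s | s) <;> rcases t with (t | t) | (t | t) <;>
    first
    | exact Sum.liftRel_inl_inl
    | exact Sum.liftRel_inr_inr
    | exact iff_of_false Sum.not_liftRel_inl_inr id
    | exact iff_of_false Sum.not_liftRel_inr_inl id

theorem sum_reindex_reindex (i : γ → α) (o : δ → β) (i' : γ' → α') (o' : δ' → β')
    (A : NetClass α β) (B : NetClass α' β') :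
    sum (reindex i o A) (reindex i' o' B) = reindex (Sum.map i i') (Sum.map o o') (sum A B) := by
  simp only [← close_eq_reindex (H := Empty) Empty.elim Empty.elim, sum_close_close]
  rw [close_eq_reindex, close_eq_reindex]

theorem sum_close_left (x : H → β) (y : H → α) (i : γ → α) (o : δ → β) (A : NetClass α β)
    (B : NetClass α' β') :
    sum (close x y i o A) B =
      close (Sum.inl ∘ x) (Sum.inl ∘ y) (Sum.map i id) (Sum.map o id) (sum A B) := by
  conv_lhs => rw [← reindex_id B]
  rw [← close_eq_reindex (H := Empty) Empty.elim Empty.elim, sum_close_close]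
  exact close_congr (Equiv.sumEmpty _ _) (by rintro (h | ⟨⟨⟩⟩); rfl) (by rintro (h | ⟨⟨⟩⟩); rfl)
    (fun _ => rfl) (fun _ => rfl) _

theorem sum_close_right (x : H → β) (y : H → α) (i : γ → α) (o : δ → β) (A : NetClass α' β')
    (B : NetClass α β) :
    sum A (close x y i o B) =
      close (Sum.inr ∘ x) (Sum.inr ∘ y) (Sum.map id i) (Sum.map id o) (sum A B) := by
  conv_lhs => rw [← reindex_id A]
  rw [← close_eq_reindex (H := Empty) Empty.elim Empty.elim, sum_close_close]
  exact close_congr (Equiv.emptySum _ _) (by rintro (⟨⟨⟩⟩ | h); rfl) (by rintro (⟨⟨⟩⟩ | h); rfl)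
    (fun _ => rfl) (fun _ => rfl) _

theorem sum_reindex_left (i : γ → α) (o : δ → β) (A : NetClass α β) (B : NetClass α' β') :
    sum (reindex i o A) B = reindex (Sum.map i id) (Sum.map o id) (sum A B) := by
  conv_lhs => rw [← reindex_id B, sum_reindex_reindex]

theorem sum_reindex_right (i : γ → α) (o : δ → β) (A : NetClass α' β') (B : NetClass α β) :
    sum A (reindex i o B) = reindex (Sum.map id i) (Sum.map id o) (sum A B) := by
  conv_lhs => rw [← reindex_id A, sum_reindex_reindex]

theorem sum_comm (A : NetClass α β) (B : NetClass α' β') :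
    sum A B = reindex Sum.swap Sum.swap (sum B A) := by
  induction A using Quotient.inductionOn with | _ A
  induction B using Quotient.inductionOn with | _ B
  refine Quotient.sound (.mk (Equiv.sumComm _ _) ?_ ?_ ?_)
  · rintro ((s | s) | (s | s)) ((t | t) | (t | t)) <;> exact Iff.rfl
  · rintro (q | q) <;> rfl
  · rintro (q | q) <;> rfl

theorem sum_assoc (A : NetClass α β) (B : NetClass α' β') (C : NetClass γ δ) :
    sum (sum A B) C =
      reindex (Equiv.sumAssoc _ _ _) (Equiv.sumAssoc _ _ _) (sum A (sum B C)) := by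
  induction A using Quotient.inductionOn with | _ A
  induction B using Quotient.inductionOn with | _ B
  induction C using Quotient.inductionOn with | _ C
  refine Quotient.sound (.mk (Equiv.sumAssoc _ _ _) ?_ ?_ ?_)
  · rintro (((s | s) | s) | ((s | s) | s)) (((t | t) | t) | ((t | t) | t)) <;>
      exact Iff.rfl
  · rintro ((q | q) | q) <;> rfl
  · rintro ((q | q) | q) <;> rfl

theorem sum_sum_sum_comm (A : NetClass α β) (B : NetClass α' β') (C : NetClass γ δ)
    (D : NetClass γ' δ') :
    sum (sum A B) (sum C D) =
      reindex (Equiv.sumSumSumComm _ _ _ _) (Equiv.sumSumSumComm _ _ _ _)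
        (sum (sum A C) (sum B D)) := by
  induction A using Quotient.inductionOn with | _ A
  induction B using Quotient.inductionOn with | _ B
  induction C using Quotient.inductionOn with | _ C
  induction D using Quotient.inductionOn with | _ D
  refine Quotient.sound (.mk (Equiv.sumSumSumComm _ _ _ _) ?_ ?_ ?_)
  · rintro (((s | s) | (s | s)) | ((s | s) | (s | s)))
      (((t | t) | (t | t)) | ((t | t) | (t | t))) <;> exact Iff.rfl
  · rintro ((q | q) | (q | q)) <;> rfl
  · rintro ((q | q) | (q | q)) <;> rfl

/-! ### Wires and their contraction -/

theorem sum_wires (f : α → β) (g : α' → β') : sum (wires f) (wires g) = wires (Sum.map f g) := by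
  refine Quotient.sound (.mk (Equiv.equivOfIsEmpty (Empty ⊕ Empty) Empty) ?_ ?_ ?_)
  · rintro ((s | s) | (⟨⟨⟩⟩ | ⟨⟨⟩⟩)) ((t | t) | (⟨⟨⟩⟩ | ⟨⟨⟩⟩)) <;>
      simp [Net.sumEdge, Net.wires]
  · rintro (⟨⟨⟩⟩ | ⟨⟨⟩⟩)
  · rintro (⟨⟨⟩⟩ | ⟨⟨⟩⟩)

theorem reindex_wires {i : γ → α} {o : δ → β} {f : α → β} {g : γ → δ} (ho : Function.Injective o)
    (h : ∀ c, f (i c) = o (g c)) : reindex i o (wires f) = wires g := by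
  refine Quotient.sound ⟨.refl _, ?_, nofun, nofun⟩
  rintro (s | ⟨⟨⟩⟩) (t | ⟨⟨⟩⟩)
  simp [Net.reindex, Net.wires, h, ho.eq_iff]

/-- Contraction of identity wires that are always followed by a hidden link (those in `V`) or
always preceded by one (those in `W`). -/
theorem close_sum_wires {V W : Type} {x : H → β} {y : H → α} {i : γ → α} {o : δ → β}
    {X : H' → β ⊕ (V ⊕ W)} {Y : H' → α ⊕ (V ⊕ W)} {I : γ → α ⊕ (V ⊕ W)} {O : δ → β ⊕ (V ⊕ W)}
    (c : V → α) (d : W → β)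
    (hH : ∀ k, (∃ h, X k = .inl (x h) ∧ Y k = .inl (y h)) ∨
      (∃ v, X k = .inr (.inl v) ∧ Y k = .inl (c v)) ∨
      (∃ w, X k = .inl (d w) ∧ Y k = .inr (.inr w)))
    (hx : ∀ h, ∃ k, X k = .inl (x h) ∧ Y k = .inl (y h))
    (hc : ∀ v, ∃ k, X k = .inr (.inl v) ∧ Y k = .inl (c v))
    (hd : ∀ w, ∃ k, X k = .inl (d w) ∧ Y k = .inr (.inr w))
    (hi : ∀ s, I s = .inl (i s) ∨ ∃ v, I s = .inr (.inl v) ∧ i s = c v)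
    (ho : ∀ t, O t = .inl (o t) ∨ ∃ w, O t = .inr (.inr w) ∧ o t = d w) (A : NetClass α β) :
    close X Y I O (sum A (wires id)) = close x y i o A := by
  induction A using Quotient.inductionOn with | _ A
  refine Quotient.sound (.mk (Equiv.sumEmpty A.Q Empty) ?_ ?_ ?_)
  · intro s t
    -- The wires have no positions, so their sources and targets are just `V ⊕ W` and their edges
    -- are equality; this is the situation of `Run.contract`.
    refine (Run.equiv_iff Net.splitPortsEmpty Net.splitPortsEmpty (.refl _)
      (R' := Sum.LiftRel A.edge (· = ·)) (x' := Sum.map Sum.inl id ∘ X)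
      (y' := Sum.map Sum.inl id ∘ Y) ?_ ?_ ?_).trans ?_
    · rintro ((s | s) | (s | ⟨⟨⟩⟩)) ((t | t) | (t | ⟨⟨⟩⟩)) <;>
      first
      | exact (Sum.liftRel_inl_inl (r := A.edge) (s := Eq)).symm
      | exact iff_of_false id Sum.not_liftRel_inl_inr
      | exact iff_of_false id Sum.not_liftRel_inr_inl
      | exact Sum.inl_injective.eq_iff.trans Sum.liftRel_inr_inr.symm
    · intro h
      simp only [Function.comp, Equiv.refl_apply]
      rcases X h with a | a <;> rfl
    · intro h
      simp only [Function.comp, Equiv.refl_apply]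
      rcases Y h with a | a <;> rfl
    · refine Run.contract (c := Sum.inl ∘ c) (d := Sum.inl ∘ d) ?_ ?_ ?_ ?_ ?_ ?_
      · intro k
        rcases hH k with ⟨h, e, e'⟩ | ⟨h, e, e'⟩ | ⟨h, e, e'⟩ <;> simp only [Function.comp, e, e']
        · exact .inl ⟨h, rfl, rfl⟩
        · exact .inr (.inl ⟨h, rfl, rfl⟩)
        · exact .inr (.inr ⟨h, rfl, rfl⟩)
      · intro h
        obtain ⟨k, e, e'⟩ := hx h
        exact ⟨k, by simp [e], by simp [e']⟩
      · intro h
        obtain ⟨k, e, e'⟩ := hc h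
        exact ⟨k, by simp [e], by simp [e']⟩
      · intro h
        obtain ⟨k, e, e'⟩ := hd h
        exact ⟨k, by simp [e], by simp [e']⟩
      · rcases s with s | (s | ⟨⟨⟩⟩)
        · rcases hi s with e | ⟨v, e, e'⟩
          · left; simp only [Sum.map_inl, e]; rfl
          · right; simp only [Sum.map_inl, e]; exact ⟨v, rfl, congrArg _ e'⟩
        · left; rfl
      · rcases t with s | (s | ⟨⟨⟩⟩)
        · rcases ho s with e | ⟨v, e, e'⟩
          · left; simp only [Sum.map_inl, e]; rfl
          · right; simp only [Sum.map_inl, e]; exact ⟨v, rfl, congrArg _ e'⟩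
        · left; rfl
  · rintro (q | ⟨⟨⟩⟩); rfl
  · rintro (q | ⟨⟨⟩⟩); rfl

/-- A network of wires is determined by where its entrances lead. -/
theorem close_wires {x : H → β} {y : H → α} {i : γ → α} {o : δ → β} {f : α → β} {g : γ → δ}
    (hx : Function.Injective x) (ho : Function.Injective o) (hxo : ∀ h d, x h ≠ o d)
    (h : ∀ c, Run (fun a b => f a = b) x y (i c) (o (g c))) :
    close x y i o (wires f) = wires g := by
  refine Quotient.sound ⟨.refl _, ?_, nofun, nofun⟩
  have key : ∀ c, Run (Net.wires f).edge (Sum.inl ∘ x) (Sum.inl ∘ y) (.inl (i c)) (.inl (o (g c))) :=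
    fun c => (h c).map (R' := (Net.wires f).edge) (x' := Sum.inl ∘ x) (y' := Sum.inl ∘ y)
      Sum.inl Sum.inl id (fun _ _ h => congrArg Sum.inl h) (fun _ => rfl) (fun _ => rfl)
  rintro (s | ⟨⟨⟩⟩) (t | ⟨⟨⟩⟩)
  constructor
  -- Wires are deterministic and no link departs from an exit kept by `o`, so the given run and the
  -- known one end at the same exit.
  · intro h'
    have := Run.unique (by rintro a _ _ rfl rfl; rfl) (Sum.inl_injective.comp hx) h' (key s)
      (fun h e => hxo h t (Sum.inl_injective e)) (fun h e => hxo h _ (Sum.inl_injective e))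
    exact congrArg Sum.inl (ho (Sum.inl_injective this.symm))
  · intro h'
    obtain rfl : g s = t := Sum.inl_injective h'
    exact key s

end NetClass

/-! ### The compact closed category of games with arbitrary open ends -/

/-- An interface: the types of rightward and of leftward open ends. -/
structure Iface : Type 1 where
  right : Type
  left : Type

namespace Iface

open NetClass

/-- Arrows between interfaces. -/
abbrev Arrow (P P' : Iface) : Type 1 := NetClass (P.right ⊕ P'.left) (P'.right ⊕ P.left)

/-- Composition: the rightward and the leftward ends in the middle are connected and hidden. -/
def comp {P P' P'' : Iface} (f : Arrow P P') (g : Arrow P' P'') : Arrow P P'' :=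
  close (H := P'.right ⊕ P'.left) (Sum.map .inl .inr) (Sum.elim (.inr ∘ .inl) (.inl ∘ .inr))
    (Sum.map .inl .inr) (Sum.elim (.inr ∘ .inl) (.inl ∘ .inr)) (sum f g)

/-- The arrow given by bijections of the rightward and of the leftward ends. -/
def wire {P P' : Iface} (e : P.right ≃ P'.right) (e' : P.left ≃ P'.left) : Arrow P P' :=
  wires (Sum.map e e'.symm)

/-- After its bijections are moved into the relabelling, `wire` consists of identity wires. The
rightward ones are followed by a hidden link and the leftward ones are preceded by one, so
`close_sum_wires` removes them all. -/
theorem wire_comp' {P P' P'' : Iface} (e : P.right ≃ P'.right) (e' : P.left ≃ P'.left)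
    (f : Arrow P' P'') : comp (wire e e') f = reindex (Sum.map e id) (Sum.map id e') f := by
  have h : wire e e' = reindex (Sum.map e id) (Sum.map id e') (wires id) := by
    refine (reindex_wires (Sum.map_injective.2 ⟨Function.injective_id, e'.injective⟩) ?_).symm
    rintro (c | c) <;> simp
  rw [comp, h, sum_reindex_left, close_reindex, sum_comm, close_reindex,
    ← close_eq_reindex (H := Empty) Empty.elim Empty.elim]
  apply close_sum_wires Sum.inl Sum.inr
  · rintro (k | k)
    · exact .inr (.inl ⟨k, rfl, rfl⟩)
    · exact .inr (.inr ⟨k, rfl, rfl⟩)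
  · rintro ⟨⟩
  · exact fun v => ⟨.inl v, rfl, rfl⟩
  · exact fun v => ⟨.inr v, rfl, rfl⟩
  · rintro (s | s)
    · exact .inr ⟨e s, rfl, rfl⟩
    · exact .inl rfl
  · rintro (s | s)
    · exact .inl rfl
    · exact .inr ⟨e' s, rfl, rfl⟩

theorem comp_wire' {P P' P'' : Iface} (e : P'.right ≃ P''.right) (e' : P'.left ≃ P''.left)
    (f : Arrow P P') :
    comp f (wire e e') = reindex (Sum.map id e'.symm) (Sum.map e.symm id) f := by
  -- Behind `f` the roles are exchanged: leftward wires are now followed by a link and rightward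
  -- ones preceded by one. Hence the leftward wires are listed first, as `V`.
  have h : wire e e' = reindex (Sum.elim Sum.inr (Sum.inl ∘ e'.symm))
      (Sum.elim (Sum.inr ∘ e.symm) Sum.inl) (wires id) := by
    refine (reindex_wires ?_ ?_).symm
    · rintro (c | c) (d | d) h <;> simp_all
    · rintro (c | c) <;> simp
  rw [comp, h, sum_reindex_right, close_reindex,
    ← close_eq_reindex (H := Empty) Empty.elim Empty.elim]
  apply close_sum_wires Sum.inr Sum.inl
  · rintro (k | k)
    · exact .inr (.inr ⟨k, rfl, rfl⟩)
    · exact .inr (.inl ⟨k, rfl, rfl⟩)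
  · rintro ⟨⟩
  · exact fun v => ⟨.inr v, rfl, rfl⟩
  · exact fun v => ⟨.inl v, rfl, rfl⟩
  · rintro (s | s)
    · exact .inl rfl
    · exact .inr ⟨_, rfl, rfl⟩
  · rintro (s | s)
    · exact .inr ⟨_, rfl, rfl⟩
    · exact .inl rfl

/-- Both sides are one closing of `f`, `g`, `h` along the links at `P₂` and at `P₃`; only the order
of the two families differs, whence `Equiv.sumComm`. -/
theorem comp_assoc' {P₁ P₂ P₃ P₄ : Iface} (f : Arrow P₁ P₂) (g : Arrow P₂ P₃) (h : Arrow P₃ P₄) :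
    comp (comp f g) h = comp f (comp g h) := by
  simp only [comp, sum_close_left, sum_close_right, close_close, sum_assoc, close_reindex]
  refine close_congr (Equiv.sumComm _ _) ?_ ?_ ?_ ?_ _
  · rintro ((_ | _) | (_ | _)) <;> rfl
  · rintro ((_ | _) | (_ | _)) <;> rfl
  · rintro (_ | _) <;> rfl
  · rintro (_ | _) <;> rfl

instance : Category.{1} Iface where
  Hom := Arrow
  id P := wire (.refl P.right) (.refl P.left)
  comp := comp
  id_comp f := (wire_comp' _ _ f).trans (by
    rw [Equiv.coe_refl, Equiv.coe_refl, Sum.map_id_id, Sum.map_id_id, reindex_id])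
  comp_id f := (comp_wire' _ _ f).trans (by
    rw [Equiv.refl_symm, Equiv.refl_symm, Equiv.coe_refl, Equiv.coe_refl, Sum.map_id_id,
      Sum.map_id_id, reindex_id])
  assoc := comp_assoc'

/-! ### Composites of wires -/

variable {P P' P'' R R' R'' : Iface}

/-- `wire` as a morphism. -/
def wireHom (e : P.right ≃ P'.right) (e' : P.left ≃ P'.left) : P ⟶ P' := wire e e'

theorem wire_comp (e : P.right ≃ P'.right) (e' : P.left ≃ P'.left) (f : P' ⟶ P'') :
    wireHom e e' ≫ f = reindex (Sum.map e id) (Sum.map id e') f := wire_comp' e e' f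

theorem comp_wire (e : P'.right ≃ P''.right) (e' : P'.left ≃ P''.left) (f : P ⟶ P') :
    f ≫ wireHom e e' = reindex (Sum.map id e'.symm) (Sum.map e.symm id) f := comp_wire' e e' f

theorem wire_comp_wire (e : P.right ≃ P'.right) (e' : P.left ≃ P'.left)
    (k : P'.right ≃ P''.right) (k' : P'.left ≃ P''.left) :
    wireHom e e' ≫ wireHom k k' = wireHom (e.trans k) (e'.trans k') := by
  rw [wire_comp]
  refine reindex_wires (Sum.map_injective.2 ⟨Function.injective_id, e'.injective⟩) ?_
  rintro (c | c) <;> simp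

/-- A composite of wires is determined by where its entrances lead. -/
theorem wires_comp_wires {f : P.right ⊕ P'.left → P'.right ⊕ P.left}
    {g : P'.right ⊕ P''.left → P''.right ⊕ P'.left} {h : P.right ⊕ P''.left → P''.right ⊕ P.left}
    (H : ∀ c, Run (H := P'.right ⊕ P'.left) (fun a b => Sum.map f g a = b)
      (Sum.map .inl .inr) (Sum.elim (.inr ∘ .inl) (.inl ∘ .inr)) (Sum.map .inl .inr c)
      (Sum.elim (.inr ∘ .inl) (.inl ∘ .inr) (h c))) :
    @CategoryStruct.comp Iface _ P P' P'' (wires f) (wires g) = wires h := by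
  refine (congrArg _ (sum_wires f g)).trans (close_wires ?_ ?_ ?_ H)
  · rintro (_ | _) (_ | _) e <;> simp_all
  · rintro (_ | _) (_ | _) e <;> simp_all
  · rintro (_ | _) (_ | _) <;> simp

/-- Isomorphisms given by bijections of the open ends. -/
def wireIso (e : P.right ≃ P'.right) (e' : P.left ≃ P'.left) : P ≅ P' where
  hom := wireHom e e'
  inv := wireHom e.symm e'.symm
  hom_inv_id := by rw [wire_comp_wire, Equiv.self_trans_symm, Equiv.self_trans_symm]; rfl
  inv_hom_id := by rw [wire_comp_wire, Equiv.symm_trans_self, Equiv.symm_trans_self]; rfl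

/-! ### Symmetric monoidal structure on interfaces -/

/-- Juxtaposition of interfaces. -/
abbrev tensor (P R : Iface) : Iface := ⟨P.right ⊕ R.right, P.left ⊕ R.left⟩

/-- Juxtaposition of arrows. -/
def tensorMap (f : P ⟶ P') (g : R ⟶ R') : tensor P R ⟶ tensor P' R' :=
  reindex (Equiv.sumSumSumComm _ _ _ _) (Equiv.sumSumSumComm _ _ _ _) (sum f g)

theorem tensorMap_wires (f : P.right ⊕ P'.left → P'.right ⊕ P.left)
    (g : R.right ⊕ R'.left → R'.right ⊕ R.left) :
    @tensorMap P P' R R' (wires f) (wires g) =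
      wires (Equiv.sumSumSumComm _ _ _ _ ∘ Sum.map f g ∘ Equiv.sumSumSumComm _ _ _ _) := by
  refine (congrArg _ (sum_wires f g)).trans (reindex_wires (Equiv.injective _) ?_)
  intro c
  exact ((Equiv.sumSumSumComm _ _ _ _).apply_symm_apply _).symm

theorem tensorMap_wire (e : P.right ≃ P'.right) (e' : P.left ≃ P'.left)
    (k : R.right ≃ R'.right) (k' : R.left ≃ R'.left) :
    tensorMap (wireHom e e') (wireHom k k') =
      wireHom (Equiv.sumCongr e k) (Equiv.sumCongr e' k') := by
  refine (tensorMap_wires _ _).trans (congrArg wires ?_)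
  funext c
  rcases c with (c | c) | (c | c) <;> rfl

/-- Both sides close the juxtaposition of all four games along the same links, which are grouped by
direction first on one side and by tensor factor first on the other. -/
theorem tensorMap_comp (f : P ⟶ P') (f' : P' ⟶ P'') (g : R ⟶ R') (g' : R' ⟶ R'') :
    tensorMap f g ≫ tensorMap f' g' = tensorMap (f ≫ f') (g ≫ g') := by
  change comp (reindex _ _ (sum f g)) (reindex _ _ (sum f' g')) =
    reindex _ _ (sum (comp f f') (comp g g'))
  simp only [comp, sum_reindex_reindex, close_reindex, sum_sum_sum_comm f g, sum_close_close,
    reindex_close]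
  refine close_congr (Equiv.sumSumSumComm _ _ _ _) ?_ ?_ ?_ ?_ _
  · rintro ((_ | _) | (_ | _)) <;> rfl
  · rintro ((_ | _) | (_ | _)) <;> rfl
  · rintro ((_ | _) | (_ | _)) <;> rfl
  · rintro ((_ | _) | (_ | _)) <;> rfl

theorem reindex_congr {α β γ δ : Type} {i i' : γ → α} {o o' : δ → β} (hi : ∀ c, i c = i' c)
    (ho : ∀ d, o d = o' d) (A : NetClass α β) : reindex i o A = reindex i' o' A := by
  rw [funext hi, funext ho]

/-- The contraction of wires with `V` and `W` empty; it gives naturality of the unitors. -/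
theorem sum_wires_empty {α β γ δ : Type} (f : Empty ⊕ Empty → Empty ⊕ Empty) {i : γ → α} {o : δ → β}
    {I : γ → (Empty ⊕ Empty) ⊕ α} {O : δ → (Empty ⊕ Empty) ⊕ β} (hi : ∀ c, I c = .inr (i c))
    (ho : ∀ d, O d = .inr (o d)) (A : NetClass α β) :
    reindex I O (sum (wires f) A) = reindex i o A := by
  obtain rfl : f = id := Subsingleton.elim _ _
  rw [sum_comm, reindex_reindex, ← close_eq_reindex (H := Empty) Empty.elim Empty.elim,
    ← close_eq_reindex (H := Empty) Empty.elim Empty.elim]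
  refine close_sum_wires Empty.elim Empty.elim nofun nofun nofun nofun ?_ ?_ A
  · exact fun c => .inl (by simp [hi])
  · exact fun c => .inl (by simp [ho])

instance : MonoidalCategoryStruct Iface where
  tensorObj := tensor
  tensorHom f g := tensorMap f g
  whiskerLeft P _ _ g := tensorMap (𝟙 P) g
  whiskerRight f R := tensorMap f (𝟙 R)
  tensorUnit := ⟨Empty, Empty⟩
  associator _ _ _ := wireIso (Equiv.sumAssoc _ _ _) (Equiv.sumAssoc _ _ _)
  leftUnitor _ := wireIso (Equiv.emptySum _ _) (Equiv.emptySum _ _)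
  rightUnitor _ := wireIso (Equiv.sumEmpty _ _) (Equiv.sumEmpty _ _)

theorem tensorMap_comm (f : P ⟶ P') (g : R ⟶ R') :
    tensorMap f g ≫ wireHom (P := tensor P' R') (P' := tensor R' P')
        (Equiv.sumComm _ _) (Equiv.sumComm _ _) =
      wireHom (P := tensor P R) (P' := tensor R P) (Equiv.sumComm _ _) (Equiv.sumComm _ _) ≫
        tensorMap g f := by
  rw [comp_wire, wire_comp, tensorMap, tensorMap, sum_comm f g, reindex_reindex, reindex_reindex,
    reindex_reindex]
  apply reindex_congr
  · rintro ((_ | _) | (_ | _)) <;> rfl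
  · rintro ((_ | _) | (_ | _)) <;> rfl

theorem tensorMap_assoc {S S' : Iface} (f : P ⟶ P') (g : R ⟶ R') (h : S ⟶ S') :
    tensorMap (tensorMap f g) h ≫ (α_ P' R' S').hom =
      (α_ P R S).hom ≫ tensorMap f (tensorMap g h) := by
  refine (comp_wire _ _ _).trans (.trans ?_ (wire_comp _ _ _).symm)
  simp only [tensorMap, sum_reindex_left, sum_reindex_right, sum_assoc, reindex_reindex]
  apply reindex_congr
  · rintro (((_ | _) | _) | (_ | (_ | _))) <;> rfl
  · rintro ((_ | (_ | _)) | ((_ | _) | _)) <;> rfl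

theorem leftUnitor_naturality' (f : P ⟶ P') :
    tensorMap (𝟙 (𝟙_ Iface)) f ≫ (λ_ P').hom = (λ_ P).hom ≫ f := by
  refine (comp_wire _ _ _).trans (.trans ?_ (wire_comp _ _ _).symm)
  rw [tensorMap, reindex_reindex]
  apply sum_wires_empty
  · rintro ((⟨⟨⟩⟩ | _) | _) <;> rfl
  · rintro (_ | (⟨⟨⟩⟩ | _)) <;> rfl

theorem rightUnitor_naturality' (f : P ⟶ P') :
    tensorMap f (𝟙 (𝟙_ Iface)) ≫ (ρ_ P').hom = (ρ_ P).hom ≫ f := by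
  refine (comp_wire _ _ _).trans (.trans ?_ (wire_comp _ _ _).symm)
  rw [tensorMap, sum_comm, reindex_reindex, reindex_reindex]
  apply sum_wires_empty
  · rintro ((_ | ⟨⟨⟩⟩) | _) <;> rfl
  · rintro (_ | (_ | ⟨⟨⟩⟩)) <;> rfl

/-- Two composites of wires agree if the underlying bijections do. -/
theorem wireHom_congr {e k : P.right ≃ P'.right} {e' k' : P.left ≃ P'.left} (h : ∀ c, e c = k c)
    (h' : ∀ c, e' c = k' c) : wireHom e e' = wireHom k k' := by
  rw [Equiv.ext h, Equiv.ext h']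

instance : MonoidalCategory Iface :=
  .ofTensorHom
    (id_tensorHom_id := fun P R => (tensorMap_wire _ _ _ _).trans
      (wireHom_congr (by rintro (_ | _) <;> rfl) (by rintro (_ | _) <;> rfl)))
    (id_tensorHom := fun _ _ _ _ => rfl)
    (tensorHom_id := fun _ _ => rfl)
    (tensorHom_comp_tensorHom := fun f g f' g' => tensorMap_comp f f' g g')
    (associator_naturality := fun f g h => tensorMap_assoc f g h)
    (leftUnitor_naturality := fun f => leftUnitor_naturality' f)
    (rightUnitor_naturality := fun f => rightUnitor_naturality' f)
    (pentagon := fun P R S T => by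
      change tensorMap (wireHom _ _) (wireHom _ _) ≫ wireHom _ _ ≫
        tensorMap (wireHom _ _) (wireHom _ _) = wireHom _ _ ≫ wireHom _ _
      rw [tensorMap_wire, tensorMap_wire, wire_comp_wire, wire_comp_wire, wire_comp_wire]
      apply wireHom_congr <;> rintro (((_ | _) | _) | _) <;> rfl)
    (triangle := fun P R => by
      change wireHom _ _ ≫ tensorMap (wireHom _ _) (wireHom _ _) =
        tensorMap (wireHom _ _) (wireHom _ _)
      rw [tensorMap_wire, tensorMap_wire, wire_comp_wire]
      apply wireHom_congr <;> rintro ((_ | ⟨⟨⟩⟩) | _) <;> rfl)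

instance : SymmetricCategory Iface where
  braiding P R :=
    wireIso (P := tensor P R) (P' := tensor R P) (Equiv.sumComm _ _) (Equiv.sumComm _ _)
  braiding_naturality_right P _ _ f := tensorMap_comm (𝟙 P) f
  braiding_naturality_left f R := tensorMap_comm f (𝟙 R)
  hexagon_forward P R S := by
    change wireHom _ _ ≫ wireHom _ _ ≫ wireHom _ _ = tensorMap (wireHom _ _) (wireHom _ _) ≫
      wireHom _ _ ≫ tensorMap (wireHom _ _) (wireHom _ _)
    rw [tensorMap_wire, tensorMap_wire, wire_comp_wire, wire_comp_wire, wire_comp_wire,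
      wire_comp_wire]
    apply wireHom_congr <;> rintro ((_ | _) | _) <;> rfl
  hexagon_reverse P R S := by
    change wireHom _ _ ≫ wireHom _ _ ≫ wireHom _ _ = tensorMap (wireHom _ _) (wireHom _ _) ≫
      wireHom _ _ ≫ tensorMap (wireHom _ _) (wireHom _ _)
    rw [tensorMap_wire, tensorMap_wire, wire_comp_wire, wire_comp_wire, wire_comp_wire,
      wire_comp_wire]
    apply wireHom_congr <;> rintro (_ | (_ | _)) <;> rfl
  symmetry P R := by
    refine (wire_comp_wire _ _ _ _).trans (wireHom_congr ?_ ?_) <;> rintro (_ | _) <;> rfl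

/-! ### Duality of interfaces -/

/-- The dual interface. -/
def dual (P : Iface) : Iface := ⟨P.left, P.right⟩

/-- Turning wires `𝟙 ⟶ P ⊗ P*`. -/
def coev (P : Iface) : 𝟙_ Iface ⟶ P ⊗ dual P :=
  wires (α := Empty ⊕ (P.left ⊕ P.right)) (β := (P.right ⊕ P.left) ⊕ Empty)
    (Sum.elim Empty.elim (.inl ∘ Sum.swap))

/-- Turning wires `P* ⊗ P ⟶ 𝟙`. -/
def ev (P : Iface) : dual P ⊗ P ⟶ 𝟙_ Iface :=
  wires (α := (P.left ⊕ P.right) ⊕ Empty) (β := Empty ⊕ (P.right ⊕ P.left))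
    (Sum.elim (.inr ∘ Sum.swap) Empty.elim)

theorem wire_comp_wires (e : P.right ≃ P'.right) (e' : P.left ≃ P'.left)
    (f : P'.right ⊕ P''.left → P''.right ⊕ P'.left) :
    wireHom e e' ≫ (show P' ⟶ P'' from wires f) =
      wires (Sum.map id e'.symm ∘ f ∘ Sum.map e id) := by
  refine (wire_comp _ _ _).trans (reindex_wires ?_ ?_)
  · exact Sum.map_injective.2 ⟨Function.injective_id, e'.injective⟩
  · intro c
    simp [Sum.map_map]

/-- Both sides of a triangle identity are wires, so it suffices to follow each entrance. Its path
crosses each of the three factors of the middle object once, reversing direction at both turning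
wires; this gives the three `step`s in every case. -/
instance exactPairing (P : Iface) : ExactPairing P (dual P) where
  coevaluation' := coev P
  evaluation' := ev P
  evaluation_coevaluation' := by
    refine (congrArg₂ _ (tensorMap_wires _ _) ((congrArg (_ ≫ ·) (tensorMap_wires _ _)).trans
      (wire_comp_wires _ _ _))).trans (.trans (wires_comp_wires ?_) (wire_comp_wire _ _ _ _).symm)
    rintro ((⟨⟨⟩⟩ | c) | (c | ⟨⟨⟩⟩))
    · exact .step (.inl (.inr c)) rfl (.step (.inr (.inl (.inr c))) rfl
        (.step (.inl (.inl (.inl c))) rfl (.edge rfl)))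
    · exact .step (.inr (.inl (.inl c))) rfl (.step (.inl (.inl (.inr c))) rfl
        (.step (.inr (.inr c)) rfl (.edge rfl)))
  coevaluation_evaluation' := by
    refine (congrArg₂ _ (tensorMap_wires _ _) ((congrArg (_ ≫ ·) (tensorMap_wires _ _)).trans
      (wire_comp_wires _ _ _))).trans (.trans (wires_comp_wires ?_) (wire_comp_wire _ _ _ _).symm)
    rintro ((c | ⟨⟨⟩⟩) | (⟨⟨⟩⟩ | c))
    · exact .step (.inl (.inl c)) rfl (.step (.inr (.inr (.inl c))) rfl
        (.step (.inl (.inr (.inr c))) rfl (.edge rfl)))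
    · exact .step (.inr (.inr (.inr c))) rfl (.step (.inl (.inr (.inl c))) rfl
        (.step (.inr (.inl c)) rfl (.edge rfl)))

end Iface

/-! ### Rightward open games as games with arbitrary open ends -/

namespace NetClass

variable {α β γ : Type}

/-- In a sequential composition all links go from left to right, so wires in front of `A` are all
followed by links: contraction with `W` empty. In `seq_wires` it is `V` that is empty. -/
theorem wires_seq (e : α → β) (A : NetClass β γ) :
    close (H := β) .inl .inr .inl .inr (sum (wires e) A) = reindex e id A := by
  have h : wires e = reindex (Sum.inl ∘ e) Sum.inl (wires (id : β ⊕ Empty → β ⊕ Empty)) :=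
    (reindex_wires (f := id) (i := Sum.inl ∘ e) (g := e) Sum.inl_injective fun _ => rfl).symm
  rw [h, sum_reindex_left, close_reindex, sum_comm, close_reindex,
    ← close_eq_reindex (H := Empty) Empty.elim Empty.elim]
  apply close_sum_wires id Empty.elim
  · exact fun k => .inr (.inl ⟨k, rfl, rfl⟩)
  · rintro ⟨⟩
  · exact fun v => ⟨v, rfl, rfl⟩
  · rintro ⟨⟩
  · exact fun s => .inr ⟨e s, rfl, rfl⟩
  · exact fun s => .inl rfl

theorem seq_wires (e : β ≃ γ) (A : NetClass α β) :
    close (H := β) .inl .inr .inl .inr (sum A (wires e)) = reindex id e.symm A := by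
  have h : wires e = reindex Sum.inr (Sum.inr ∘ e.symm) (wires (id : Empty ⊕ β → Empty ⊕ β)) :=
    (reindex_wires (Sum.inr_injective.comp e.symm.injective) fun _ => by simp).symm
  rw [h, sum_reindex_right, close_reindex, ← close_eq_reindex (H := Empty) Empty.elim Empty.elim]
  apply close_sum_wires Empty.elim id
  · exact fun k => .inr (.inr ⟨k, rfl, rfl⟩)
  · rintro ⟨⟩
  · rintro ⟨⟩
  · exact fun v => ⟨v, rfl, rfl⟩
  · exact fun s => .inl rfl
  · exact fun s => .inr ⟨e.symm s, rfl, rfl⟩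

end NetClass

namespace ROMPG

/-- A rightward open game as a game with open ends in `Fin m` and `Fin n`. -/
def toNet {m n : ℕ} (A : ROMPG m n) : Net (Fin m) (Fin n) where
  Q := A.Q
  edge := A.edge
  role := A.role
  weight := A.weight

end ROMPG

namespace ROHom

open NetClass

variable {m n k l : ℕ}

/-- See `ROMPG.toNet`. -/
def toNet (A : ROHom m n) : NetClass (Fin m) (Fin n) :=
  Quotient.map ROMPG.toNet (fun _ _ h => h) A

theorem toNet_injective : Function.Injective (toNet : ROHom m n → _) := by
  intro A B h
  induction A using Quotient.inductionOn with | _ A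
  induction B using Quotient.inductionOn with | _ B
  have h' : Net.Iso A.toNet B.toNet := Quotient.exact h
  exact Quotient.sound h'

theorem toNet_wires (e : Fin m ≃ Fin n) : toNet (wires e) = NetClass.wires e := by
  refine Quotient.sound ⟨.refl _, ?_, nofun, nofun⟩
  rintro (s | ⟨⟨⟩⟩) (t | ⟨⟨⟩⟩)
  exact Sum.inl_injective.eq_iff.symm

/-- A run crosses at most one hidden link: a link leads into `B`, and no edge leads from there to an
exit of `A`. -/
theorem toNet_seq (A : ROHom m l) (B : ROHom l n) :
    toNet (seq A B) = close (H := Fin l) .inl .inr .inl .inr (A.toNet.sum B.toNet) := by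
  induction A using Quotient.inductionOn with | _ A
  induction B using Quotient.inductionOn with | _ B
  refine Quotient.sound (.mk (.refl (A.Q ⊕ B.Q)) ?_ (fun _ => rfl) (fun _ => rfl))
  have direct : ∀ {s t}, (A.toNet.sum B.toNet).edge s t → Run (A.toNet.sum B.toNet).edge
      (Sum.inl ∘ Sum.inl) (Sum.inl ∘ Sum.inr) s t := .edge
  have via : ∀ {s t} (j : Fin l), (A.toNet.sum B.toNet).edge s (.inl (.inl j)) →
      (A.toNet.sum B.toNet).edge (.inl (.inr j)) t → Run (A.toNet.sum B.toNet).edge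
      (Sum.inl ∘ Sum.inl) (Sum.inl ∘ Sum.inr) s t := fun j h h' => .step j h (.edge h')
  have cases : ∀ {s t}, Run (A.toNet.sum B.toNet).edge (Sum.inl ∘ Sum.inl) (Sum.inl ∘ Sum.inr) s t →
      (A.toNet.sum B.toNet).edge s t ∨ ∃ j : Fin l, (A.toNet.sum B.toNet).edge s (.inl (.inl j)) ∧
        (A.toNet.sum B.toNet).edge (.inl (.inr j)) t := by
    intro s t h
    cases h with
    | edge h => exact .inl h
    | step j h h' =>
      cases h' with
      | edge h' => exact .inr ⟨j, h, h'⟩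
      | step _ h' => exact h'.elim
  rintro (s | s | s) (t | t | t)
  · exact ⟨fun ⟨j, h, h'⟩ => via j h h', fun h => (cases h).elim False.elim _root_.id⟩
  · exact ⟨fun h => direct h, fun h => (cases h).elim _root_.id fun ⟨_, _, h⟩ => h.elim⟩
  · exact ⟨fun ⟨j, h, h'⟩ => via j h h', fun h => (cases h).elim False.elim _root_.id⟩
  · exact ⟨fun ⟨j, h, h'⟩ => via j h h', fun h => (cases h).elim False.elim _root_.id⟩
  · exact ⟨fun h => direct h, fun h => (cases h).elim _root_.id fun ⟨_, _, h⟩ => h.elim⟩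
  · exact ⟨fun ⟨j, h, h'⟩ => via j h h', fun h => (cases h).elim False.elim _root_.id⟩
  · exact ⟨fun h => direct h, fun h => (cases h).elim _root_.id fun ⟨_, h, _⟩ => h.elim⟩
  · exact ⟨False.elim, fun h => (cases h).elim _root_.id fun ⟨_, h, _⟩ => h.elim⟩
  · exact ⟨fun h => direct h, fun h => (cases h).elim _root_.id fun ⟨_, h, _⟩ => h.elim⟩

theorem toNet_sum (A : ROHom m n) (B : ROHom k l) :
    toNet (sum A B) =
      reindex finSumFinEquiv.symm finSumFinEquiv.symm (A.toNet.sum B.toNet) := by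
  induction A using Quotient.inductionOn with | _ A
  induction B using Quotient.inductionOn with | _ B
  refine Quotient.sound (.mk (.refl (A.Q ⊕ B.Q)) ?_ (fun _ => rfl) (fun _ => rfl))
  -- `left` and `right` turn the two disjuncts in the definition of `ROMPG.sum` into the two cases
  -- of `Sum.LiftRel`.
  have left : ∀ {p q : ℕ} (a : Fin p ⊕ A.Q) (s : Fin (p + q) ⊕ (A.Q ⊕ B.Q)),
      s = a.map (Fin.castAdd q) Sum.inl ↔
        Net.splitPorts (s.map finSumFinEquiv.symm _root_.id) = .inl a := by
    intro p q a s
    rw [← Equiv.eq_symm_apply]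
    rcases s with s | s | s <;> rcases a with a | a <;>
      simp [Net.splitPorts, Equiv.symm_apply_eq]
  have right : ∀ {p q : ℕ} (a : Fin q ⊕ B.Q) (s : Fin (p + q) ⊕ (A.Q ⊕ B.Q)),
      s = a.map (Fin.natAdd p) Sum.inr ↔
        Net.splitPorts (s.map finSumFinEquiv.symm _root_.id) = .inr a := by
    intro p q a s
    rw [← Equiv.eq_symm_apply]
    rcases s with s | s | s <;> rcases a with a | a <;>
      simp [Net.splitPorts, Equiv.symm_apply_eq]
  intro (s : Fin (m + k) ⊕ (A.Q ⊕ B.Q)) (t : Fin (n + l) ⊕ (A.Q ⊕ B.Q))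
  refine Iff.trans ?_ Net.sumEdge_iff.symm
  change ((∃ a b, A.edge a b ∧ s = a.map (Fin.castAdd k) Sum.inl ∧
      t = b.map (Fin.castAdd l) Sum.inl) ∨
    (∃ a b, B.edge a b ∧ s = a.map (Fin.natAdd m) Sum.inr ∧ t = b.map (Fin.natAdd n) Sum.inr)) ↔ _
  simp only [left, right]
  change _ ↔ Sum.LiftRel A.edge B.edge
    (Net.splitPorts ((s.map _root_.id (Equiv.refl (A.Q ⊕ B.Q))).map finSumFinEquiv.symm _root_.id))
    (Net.splitPorts ((t.map _root_.id (Equiv.refl (A.Q ⊕ B.Q))).map finSumFinEquiv.symm _root_.id))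
  rw [Equiv.coe_refl, Sum.map_id_id, Sum.map_id_id, id_eq, id_eq]
  generalize Net.splitPorts (s.map finSumFinEquiv.symm _root_.id) = s
  generalize Net.splitPorts (t.map finSumFinEquiv.symm _root_.id) = t
  constructor
  · rintro (⟨a, b, h, rfl, rfl⟩ | ⟨a, b, h, rfl, rfl⟩)
    · exact .inl h
    · exact .inr h
  · rintro (h | h)
    · exact .inl ⟨_, _, h, rfl, rfl⟩
    · exact .inr ⟨_, _, h, rfl, rfl⟩

theorem toNet_tr (A : ROHom (l + m) (l + n)) :
    toNet (tr l A) = close (Fin.castAdd n) (Fin.castAdd m) (Fin.natAdd l) (Fin.natAdd l) A.toNet := by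
  induction A using Quotient.inductionOn with | _ A
  refine Quotient.sound (.mk (.refl A.Q) ?_ (fun _ => rfl) (fun _ => rfl))
  have key : ∀ s t, A.TracePath s t ↔
      Run A.edge (Sum.inl ∘ Fin.castAdd n) (Sum.inl ∘ Fin.castAdd m) s t := by
    intro s t
    constructor
    · intro h
      induction h with
      | edge h => exact .edge h
      | cons i h _ ih => exact .step i h ih
    · intro h
      induction h with
      | edge h => exact .edge h
      | step i h _ ih => exact .cons i h ih
  intro s t
  refine (key _ _).trans (iff_of_eq ?_)
  rcases s with s | s <;> rcases t with t | t <;> rfl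

theorem toNet_cast {m' n' : ℕ} (hm : m = m') (hn : n = n') (A : ROHom m n) :
    toNet (cast hm hn A) = reindex (Fin.cast hm.symm) (Fin.cast hn.symm) A.toNet := by
  subst hm hn
  exact (reindex_id _).symm

theorem sum_wires (e : Fin m ≃ Fin n) (e' : Fin k ≃ Fin l) :
    sum (wires e) (wires e') =
      wires (finSumFinEquiv.symm.trans ((Equiv.sumCongr e e').trans finSumFinEquiv)) := by
  apply toNet_injective
  rw [toNet_sum, toNet_wires, toNet_wires, toNet_wires, NetClass.sum_wires]
  exact reindex_wires (Equiv.injective _) fun c => by simp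

theorem cast_wires {m' n' : ℕ} (hm : m = m') (hn : n = n') (e : Fin m ≃ Fin n) :
    cast hm hn (wires e) = wires ((finCongr hm.symm).trans (e.trans (finCongr hn))) := by
  subst hm hn
  rfl

theorem toNet_wires_seq (e : Fin m ≃ Fin l) (A : ROHom l n) :
    toNet (seq (wires e) A) = reindex e _root_.id A.toNet := by
  rw [toNet_seq, toNet_wires, NetClass.wires_seq]

theorem toNet_seq_wires (A : ROHom m l) (e : Fin l ≃ Fin n) :
    toNet (seq A (wires e)) = reindex _root_.id e.symm A.toNet := by
  rw [toNet_seq, toNet_wires, NetClass.seq_wires]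

end ROHom

/-! ### The embedding of open mean payoff games -/

/-! ### Casts between bracketings of sums of arities -/

@[simp] theorem Fin.cast_castAdd_castAdd {m n p : ℕ} (h : m + n + p = m + (n + p)) (i : Fin m) :
    Fin.cast h (Fin.castAdd p (Fin.castAdd n i)) = Fin.castAdd (n + p) i := rfl

@[simp] theorem Fin.cast_castAdd_natAdd {m n p : ℕ} (h : m + n + p = m + (n + p)) (i : Fin n) :
    Fin.cast h (Fin.castAdd p (Fin.natAdd m i)) = Fin.natAdd m (Fin.castAdd p i) := rfl

@[simp] theorem Fin.cast_natAdd_assoc {m n p : ℕ} (h : m + n + p = m + (n + p)) (i : Fin p) :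
    Fin.cast h (Fin.natAdd (m + n) i) = Fin.natAdd m (Fin.natAdd n i) :=
  Fin.ext (Nat.add_assoc _ _ _)

@[simp] theorem Fin.cast_castAdd_assoc {m n p : ℕ} (h : m + (n + p) = m + n + p) (i : Fin m) :
    Fin.cast h (Fin.castAdd (n + p) i) = Fin.castAdd p (Fin.castAdd n i) := rfl

@[simp] theorem Fin.cast_natAdd_castAdd {m n p : ℕ} (h : m + (n + p) = m + n + p) (i : Fin n) :
    Fin.cast h (Fin.natAdd m (Fin.castAdd p i)) = Fin.castAdd p (Fin.natAdd m i) := rfl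

@[simp] theorem Fin.cast_natAdd_natAdd {m n p : ℕ} (h : m + (n + p) = m + n + p) (i : Fin p) :
    Fin.cast h (Fin.natAdd m (Fin.natAdd n i)) = Fin.natAdd (m + n) i :=
  Fin.ext (Nat.add_assoc _ _ _).symm

@[simp] theorem Fin.cast_castAdd_castAdd_middle {a b c d : ℕ} (h : a + b + (c + d) = a + (b + c) + d)
    (i : Fin a) :
    Fin.cast h (Fin.castAdd (c + d) (Fin.castAdd b i)) = Fin.castAdd d (Fin.castAdd (b + c) i) := rfl

@[simp] theorem Fin.cast_castAdd_natAdd_middle {a b c d : ℕ} (h : a + b + (c + d) = a + (b + c) + d)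
    (i : Fin b) : Fin.cast h (Fin.castAdd (c + d) (Fin.natAdd a i)) =
      Fin.castAdd d (Fin.natAdd a (Fin.castAdd c i)) := rfl

@[simp] theorem Fin.cast_natAdd_castAdd_middle {a b c d : ℕ} (h : a + b + (c + d) = a + (b + c) + d)
    (i : Fin c) : Fin.cast h (Fin.natAdd (a + b) (Fin.castAdd d i)) =
      Fin.castAdd d (Fin.natAdd a (Fin.natAdd b i)) :=
  Fin.ext (Nat.add_assoc _ _ _)

@[simp] theorem Fin.cast_natAdd_natAdd_middle {a b c d : ℕ} (h : a + b + (c + d) = a + (b + c) + d)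
    (i : Fin d) : Fin.cast h (Fin.natAdd (a + b) (Fin.natAdd c i)) = Fin.natAdd (a + (b + c)) i :=
  Fin.ext (by simp only [Fin.val_cast, Fin.val_natAdd]; omega)

@[simp] theorem finAddFlip_symm {m n : ℕ} :
    (finAddFlip : Fin (m + n) ≃ Fin (n + m)).symm = finAddFlip := rfl

namespace OMPG

open NetClass

/-- The interface of an object. -/
abbrev iface (m : OMPG) : Iface := ⟨Fin m.right, Fin m.left⟩

/-- An open mean payoff game as an arrow between interfaces. -/
def toArrow {m n : OMPG} (f : m.Arrow n) :
    NetClass (Fin m.right ⊕ Fin n.left) (Fin n.right ⊕ Fin m.left) :=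
  reindex finSumFinEquiv finSumFinEquiv f.toNet

theorem toNet_eq {m n : OMPG} (f : m.Arrow n) :
    f.toNet = reindex finSumFinEquiv.symm finSumFinEquiv.symm (toArrow f) := by
  rw [toArrow, reindex_reindex, Equiv.self_comp_symm, Equiv.self_comp_symm, reindex_id]

theorem toArrow_injective {m n : OMPG} : Function.Injective (toArrow : m.Arrow n → _) := by
  intro f g h
  apply ROHom.toNet_injective
  rw [toNet_eq, toNet_eq, h]

theorem toArrow_wires {m n : OMPG} (e : Fin (m.right + n.left) ≃ Fin (n.right + m.left)) :
    toArrow (m := m) (n := n) (ROHom.wires e) =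
      wires (finSumFinEquiv.trans (e.trans finSumFinEquiv.symm)) := by
  rw [toArrow, ROHom.toNet_wires]
  exact reindex_wires (Equiv.injective _) fun c => by simp

theorem toArrow_id (m : OMPG) :
    toArrow (id m) = Iface.wire (P := m.iface) (P' := m.iface) (.refl _) (.refl _) := by
  rw [id, ROHom.id, toArrow_wires, Iface.wire]
  congr 1
  funext c
  rcases c with c | c <;> simp

/-- The symmetries in the formula only relabel ends. What remains is one sequential composition of
`f ⊕ id` with `g ⊕ id` inside a trace, that is, one closing of `f`, `g` and identity wires on
`n.left` and `m.left`. The former wires lead into `g`, the latter come from `f`, and both are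
contracted. -/
theorem toArrow_comp {m l n : OMPG} (f : m.Arrow l) (g : l.Arrow n) :
    toArrow (comp f g) =
      Iface.comp (P := m.iface) (P' := l.iface) (P'' := n.iface) (toArrow f) (toArrow g) := by
  rw [toArrow, comp, ROHom.swap, ROHom.swap, ROHom.swap, ROHom.id, ROHom.id, ROHom.id]
  simp only [ROHom.sum_wires, ROHom.cast_wires]
  rw [ROHom.toNet_tr, ROHom.toNet_cast, ROHom.toNet_seq_wires, ROHom.toNet_seq,
    ROHom.toNet_seq_wires, ROHom.toNet_wires_seq, ROHom.toNet_sum, ROHom.toNet_sum,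
    ROHom.toNet_wires, ROHom.toNet_wires, toNet_eq, toNet_eq]
  simp only [reindex_close, close_reindex, sum_reindex_left, sum_reindex_right, reindex_reindex,
    close_close, sum_sum_sum_comm _ (wires _), NetClass.sum_wires, Equiv.coe_refl, Sum.map_id_id]
  unfold Iface.comp
  refine close_sum_wires (Sum.inr ∘ Sum.inr) (Sum.inl ∘ Sum.inr) ?_ ?_ ?_ ?_ ?_ ?_ _
  · rintro (k | k)
    -- The links of the sequential composition lie in the blocks `l.right`, `n.left` and `m.left`:
    -- links of `Iface.comp`, links behind a wire, links in front of a wire. The links of the trace,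
    -- treated next, are those at `l.left`.
    · refine Fin.addCases (Fin.addCases (fun k => .inl ⟨.inl k, ?_⟩) fun k => .inr (.inl ⟨k, ?_⟩))
        (fun k => .inr (.inr ⟨k, ?_⟩)) k <;> simp
    · exact .inl ⟨.inr k, by simp⟩
  · rintro (h | h)
    · exact ⟨.inl (Fin.castAdd _ (Fin.castAdd _ h)), by simp⟩
    · exact ⟨.inr h, by simp⟩
  · exact fun h => ⟨.inl (Fin.castAdd _ (Fin.natAdd _ h)), by simp⟩
  · exact fun h => ⟨.inl (Fin.natAdd _ h), by simp⟩
  · rintro (s | s)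
    · left; simp
    · right; refine ⟨s, ?_⟩; simp
  · rintro (s | s)
    · left; simp
    · right; refine ⟨s, ?_⟩; simp

/-- Collects the wires on both sides of `A` in one factor, as `close_sum_wires` requires. -/
theorem sum_wires_wires {α β γ δ γ' δ' : Type} (A : NetClass α β) (f : γ → δ) (g : γ' → δ') :
    sum (sum (wires f) A) (wires g) =
      reindex (Equiv.sumAssoc _ _ _ ∘ Sum.map Sum.swap _root_.id)
        (Equiv.sumAssoc _ _ _ ∘ Sum.map Sum.swap _root_.id) (sum A (wires (Sum.map f g))) := by
  rw [sum_comm (wires f), sum_reindex_left, sum_assoc, reindex_reindex, NetClass.sum_wires]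

/-- The layer of `f` is followed by the layer of `g`. Each link between them meets an identity wire:
either a wire beside `f` leading into `g`, or a wire beside `g` coming from `f`. Contraction leaves
`f` and `g` with no links at all. -/
theorem toArrow_sumHom {m n k l : OMPG} (f : m.Arrow n) (g : k.Arrow l) :
    toArrow (m := sumObj m k) (n := sumObj n l) (sumHom f g) =
      reindex
        (Equiv.sumSumSumComm _ _ _ _ ∘ Sum.map finSumFinEquiv.symm (Sum.swap ∘ finSumFinEquiv.symm))
        (Equiv.sumSumSumComm _ _ _ _ ∘ Sum.map finSumFinEquiv.symm (Sum.swap ∘ finSumFinEquiv.symm))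
        (sum (toArrow f) (toArrow g)) := by
  have h : k.right + (m.right + n.left) + l.left = k.right + m.right + (n.left + l.left) ∧
      k.right + (n.right + m.left) + l.left = k.right + n.right + (m.left + l.left) ∧
      n.right + (k.right + l.left) + m.left = n.right + k.right + (l.left + m.left) ∧
      n.right + (l.right + k.left) + m.left = n.right + l.right + (k.left + m.left) := by omega
  -- The arities are written as sums of numbers instead of components of `sumObj`.
  change reindex (finSumFinEquiv (m := m.right + k.right) (n := l.left + n.left))
    (finSumFinEquiv (m := n.right + l.right) (n := k.left + m.left)) (ROHom.toNet
      (((((ROHom.swap m.right k.right).sum (ROHom.swap l.left n.left)).seq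
        (ROHom.cast h.1 h.2.1 (((ROHom.id k.right).sum f).sum (ROHom.id l.left)))).seq
        ((ROHom.swap k.right n.right).sum (ROHom.swap m.left l.left))).seq
        (ROHom.cast h.2.2.1 h.2.2.2 (((ROHom.id n.right).sum g).sum (ROHom.id m.left))))) = _
  rw [ROHom.swap, ROHom.swap, ROHom.swap, ROHom.swap, ROHom.id, ROHom.id, ROHom.id,
    ROHom.id, ROHom.sum_wires, ROHom.sum_wires]
  rw [ROHom.toNet_seq, ROHom.toNet_seq_wires, ROHom.toNet_wires_seq, ROHom.toNet_cast,
    ROHom.toNet_cast]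
  simp only [ROHom.toNet_sum, ROHom.toNet_wires, toNet_eq f, toNet_eq g]
  simp only [reindex_close, close_reindex, sum_reindex_left, sum_reindex_right, reindex_reindex,
    sum_wires_wires, sum_sum_sum_comm _ (wires _), NetClass.sum_wires, Equiv.coe_refl, Sum.map_id_id]
  rw [← close_eq_reindex (H := Empty) Empty.elim Empty.elim]
  refine close_sum_wires (V := Fin k.right ⊕ Fin l.left) (W := Fin n.right ⊕ Fin m.left)
    Sum.inr Sum.inl ?_ ?_ ?_ ?_ ?_ ?_ _
  -- The blocks are `n.right`, `k.right`, `l.left`, `m.left`. The outer two lead from `f` into wires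
  -- beside `g`, the inner two lead from wires beside `f` into `g`.
  · refine Fin.addCases (Fin.addCases (fun k => .inr (.inr ⟨.inl k, ?_⟩))
      (fun k => .inr (.inl ⟨.inl k, ?_⟩))) (Fin.addCases (fun k => .inr (.inl ⟨.inr k, ?_⟩))
        (fun k => .inr (.inr ⟨.inr k, ?_⟩))) <;> simp
  · rintro ⟨⟩
  · rintro (h | h)
    · exact ⟨Fin.castAdd _ (Fin.natAdd _ h), by simp⟩
    · exact ⟨Fin.natAdd _ (Fin.castAdd _ h), by simp⟩
  · rintro (h | h)
    · exact ⟨Fin.castAdd _ (Fin.castAdd _ h), by simp⟩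
    · exact ⟨Fin.natAdd _ (Fin.natAdd _ h), by simp⟩
  · rintro (s | s)
    · refine Fin.addCases (fun s => ?_) (fun s => ?_) s
      · left; simp
      · right; refine ⟨.inl s, ?_⟩; simp
    · refine Fin.addCases (fun s => ?_) (fun s => ?_) s
      · right; refine ⟨.inr s, ?_⟩; simp
      · left; simp
  · rintro (s | s)
    · refine Fin.addCases (fun s => ?_) (fun s => ?_) s
      · right; refine ⟨.inl s, ?_⟩; simp
      · left; simp
    · refine Fin.addCases (fun s => ?_) (fun s => ?_) s
      · left; simp
      · right; refine ⟨.inr s, ?_⟩; simp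

end OMPG

/-! ### Open mean payoff games form a compact closed category -/

/-! ### Structural bijections in terms of `Fin` -/

namespace Fin

theorem sumAssoc_apply {m k l : ℕ} (h : m + k + l = m + (k + l)) (c : Fin (m + k + l)) :
    finCongr h c = ((finSumFinEquiv.symm.trans (Equiv.sumCongr finSumFinEquiv.symm (.refl _))).trans
      ((Equiv.sumAssoc _ _ _).trans
        ((Equiv.sumCongr (.refl _) finSumFinEquiv).trans finSumFinEquiv))) c := by
  refine Fin.addCases (Fin.addCases ?_ ?_) ?_ c <;> intro c <;> simp

/-- The version for leftward ends, which `sumObj` lists in reverse order; this is the reason for the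
inserted `Equiv.sumComm`, here and in the other `_comm` lemmas. -/
theorem sumAssoc_comm_apply {m k l : ℕ} (h : l + (k + m) = l + k + m) (c : Fin (l + (k + m))) :
    finCongr h c =
      ((((Equiv.sumComm _ _).trans finSumFinEquiv).symm.trans
          (Equiv.sumCongr ((Equiv.sumComm _ _).trans finSumFinEquiv).symm (.refl _))).trans
        ((Equiv.sumAssoc (Fin m) (Fin k) (Fin l)).trans
          ((Equiv.sumCongr (.refl _) ((Equiv.sumComm _ _).trans finSumFinEquiv)).trans
            ((Equiv.sumComm _ _).trans finSumFinEquiv)))) c := by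
  refine Fin.addCases ?_ (Fin.addCases ?_ ?_) c <;> intro c <;> simp

theorem emptySum_apply {m : ℕ} (h : 0 + m = m) (c : Fin (0 + m)) :
    finCongr h c = ((finSumFinEquiv.symm.trans
      (Equiv.sumCongr (Equiv.equivOfIsEmpty Empty (Fin 0)).symm (.refl _))).trans
        (Equiv.emptySum Empty _)) c := by
  obtain ⟨c, rfl⟩ := finSumFinEquiv.surjective c
  rcases c with c | c
  · exact c.elim0
  · simp only [Equiv.trans_apply, Equiv.symm_apply_apply]
    exact Fin.ext (Nat.zero_add _)

theorem emptySum_comm_apply {m : ℕ} (h : m + 0 = m) (c : Fin (m + 0)) :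
    finCongr h c = ((((Equiv.sumComm _ _).trans finSumFinEquiv).symm.trans
      (Equiv.sumCongr (Equiv.equivOfIsEmpty Empty (Fin 0)).symm (.refl _))).trans
        (Equiv.emptySum Empty _)) c := by
  obtain ⟨c, rfl⟩ := finSumFinEquiv.surjective c
  rcases c with c | c
  · simp only [Equiv.trans_apply, Equiv.symm_trans_apply, Equiv.symm_apply_apply]
    rfl
  · exact c.elim0

theorem sumEmpty_apply {m : ℕ} (h : m + 0 = m) (c : Fin (m + 0)) :
    finCongr h c = ((finSumFinEquiv.symm.trans
      (Equiv.sumCongr (.refl _) (Equiv.equivOfIsEmpty Empty (Fin 0)).symm)).trans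
        (Equiv.sumEmpty _ Empty)) c := by
  obtain ⟨c, rfl⟩ := finSumFinEquiv.surjective c
  rcases c with c | c
  · simp only [Equiv.trans_apply, Equiv.symm_apply_apply]
    rfl
  · exact c.elim0

theorem sumEmpty_comm_apply {m : ℕ} (h : 0 + m = m) (c : Fin (0 + m)) :
    finCongr h c = ((((Equiv.sumComm _ _).trans finSumFinEquiv).symm.trans
      (Equiv.sumCongr (.refl _) (Equiv.equivOfIsEmpty Empty (Fin 0)).symm)).trans
        (Equiv.sumEmpty _ Empty)) c := by
  obtain ⟨c, rfl⟩ := finSumFinEquiv.surjective c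
  rcases c with c | c
  · exact c.elim0
  · simp only [Equiv.trans_apply, Equiv.symm_trans_apply, Equiv.symm_apply_apply]
    exact Fin.ext (Nat.zero_add _)

/-- Reversing the leftward ends makes the identity a turning wire: both the rightward and the
leftward ends of `m ⊕ m*` number `m.right + m.left`, in this order, and equal positions belong to
dual ends. -/
theorem coev_apply {a b : ℕ} (h : 0 + (a + b) = a + b) (h' : a + b = a + b + 0)
    (c : Fin 0 ⊕ Fin (a + b)) :
    (finSumFinEquiv.trans (((finCongr h).trans ((Equiv.refl _).trans (finCongr h'))).trans
      finSumFinEquiv.symm)) c =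
    (Sum.map finSumFinEquiv (Equiv.equivOfIsEmpty Empty (Fin 0)).symm.symm ∘
      Sum.elim Empty.elim (Sum.inl ∘ Sum.swap) ∘ Sum.map (Equiv.equivOfIsEmpty Empty (Fin 0)).symm
        ((Equiv.sumComm (Fin b) (Fin a)).trans finSumFinEquiv).symm) c := by
  rcases c with c | c
  · exact c.elim0
  · obtain ⟨c, rfl⟩ := finSumFinEquiv.surjective c
    refine finSumFinEquiv.injective (Fin.ext ?_)
    rcases c with c | c <;> simp

theorem ev_apply {a b : ℕ} (h : b + a + 0 = b + a) (h' : b + a = 0 + (b + a))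
    (c : Fin (b + a) ⊕ Fin 0) :
    (finSumFinEquiv.trans (((finCongr h).trans ((Equiv.refl _).trans (finCongr h'))).trans
      finSumFinEquiv.symm)) c =
    (Sum.map (Equiv.equivOfIsEmpty Empty (Fin 0))
        ((Equiv.sumComm (Fin a) (Fin b)).trans finSumFinEquiv).symm.symm ∘
      Sum.elim (Sum.inr ∘ Sum.swap) Empty.elim ∘
        Sum.map finSumFinEquiv.symm (Equiv.equivOfIsEmpty Empty (Fin 0)).symm) c := by
  rcases c with c | c
  · obtain ⟨c, rfl⟩ := finSumFinEquiv.surjective c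
    refine finSumFinEquiv.injective (Fin.ext ?_)
    rcases c with c | c <;> simp
  · exact c.elim0

end Fin

/-! ### Structure maps of interfaces conjugated by wires -/

namespace Iface

variable {P P' R R' S PR RS T T' : Iface}

theorem wire_comp_tensorMap_comp_wire (e : T.right ≃ P.right ⊕ R.right)
    (e' : T.left ≃ P.left ⊕ R.left) (f : P ⟶ P') (g : R ⟶ R')
    (k : P'.right ⊕ R'.right ≃ T'.right) (k' : P'.left ⊕ R'.left ≃ T'.left) :
    wireHom (P' := tensor P R) e e' ≫ tensorMap f g ≫ wireHom (P := tensor P' R') k k' =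
      NetClass.reindex (Equiv.sumSumSumComm _ _ _ _ ∘ Sum.map e k'.symm)
        (Equiv.sumSumSumComm _ _ _ _ ∘ Sum.map k.symm e') (NetClass.sum f g) := by
  rw [comp_wire, wire_comp, tensorMap, NetClass.reindex_reindex, NetClass.reindex_reindex]
  apply reindex_congr <;> rintro (_ | _) <;> rfl

theorem wire_comp_wires_comp_wire (e : T.right ≃ P.right) (e' : T.left ≃ P.left)
    (f : P.right ⊕ P'.left → P'.right ⊕ P.left) (k : P'.right ≃ T'.right)
    (k' : P'.left ≃ T'.left) :
    wireHom e e' ≫ (show P ⟶ P' from NetClass.wires f) ≫ wireHom k k' =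
      NetClass.wires (Sum.map k e'.symm ∘ f ∘ Sum.map e k'.symm) := by
  rw [comp_wire, wire_comp, NetClass.reindex_reindex]
  refine NetClass.reindex_wires ?_ fun c => ?_
  · exact (Sum.map_injective.2 ⟨k.symm.injective, Function.injective_id⟩).comp
      (Sum.map_injective.2 ⟨Function.injective_id, e'.injective⟩)
  · rcases c with c | c <;> simp [Sum.map_map]

/-- The composite that `Monoidal.InducingFunctorData` prescribes for an associator consists of
wires, so only two bijections have to be compared with the casts of `OMPG`. -/
theorem wire_associator (a : P.right ⊕ R.right ≃ PR.right) (a' : P.left ⊕ R.left ≃ PR.left)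
    (b : PR.right ⊕ S.right ≃ T.right) (b' : PR.left ⊕ S.left ≃ T.left)
    (c : R.right ⊕ S.right ≃ RS.right) (c' : R.left ⊕ S.left ≃ RS.left)
    (d : P.right ⊕ RS.right ≃ T'.right) (d' : P.left ⊕ RS.left ≃ T'.left) :
    (((wireIso (P := tensor PR S) b b').symm ≪≫ ((wireIso (P := tensor P R) a a').symm ⊗ᵢ .refl S)) ≪≫
      α_ P R S ≪≫ ((.refl P ⊗ᵢ wireIso (P := tensor R S) c c') ≪≫
        wireIso (P := tensor P RS) d d')).hom =
      wireHom
        (((b.symm.trans (Equiv.sumCongr a.symm (.refl _))).trans ((Equiv.sumAssoc _ _ _).trans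
          ((Equiv.sumCongr (.refl _) c).trans d))))
        (((b'.symm.trans (Equiv.sumCongr a'.symm (.refl _))).trans ((Equiv.sumAssoc _ _ _).trans
          ((Equiv.sumCongr (.refl _) c').trans d')))) := by
  change (wireHom _ _ ≫ tensorMap (wireHom _ _) (wireHom _ _)) ≫ wireHom _ _ ≫
    tensorMap (wireHom _ _) (wireHom _ _) ≫ wireHom _ _ = _
  rw [tensorMap_wire, tensorMap_wire, wire_comp_wire, wire_comp_wire, wire_comp_wire,
    wire_comp_wire]

theorem wire_leftUnitor (a : Empty ≃ R.right) (a' : Empty ≃ R.left)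
    (b : R.right ⊕ P.right ≃ T.right) (b' : R.left ⊕ P.left ≃ T.left) :
    (((wireIso (P := tensor R P) b b').symm ≪≫
      ((wireIso (P := ⟨Empty, Empty⟩) a a').symm ⊗ᵢ .refl P)) ≪≫ λ_ P).hom =
      wireHom ((b.symm.trans (Equiv.sumCongr a.symm (.refl _))).trans (Equiv.emptySum _ _))
        ((b'.symm.trans (Equiv.sumCongr a'.symm (.refl _))).trans (Equiv.emptySum _ _)) := by
  change (wireHom _ _ ≫ tensorMap (wireHom _ _) (wireHom _ _)) ≫ wireHom _ _ = _
  rw [tensorMap_wire, wire_comp_wire, wire_comp_wire]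

theorem wire_rightUnitor (a : Empty ≃ R.right) (a' : Empty ≃ R.left)
    (b : P.right ⊕ R.right ≃ T.right) (b' : P.left ⊕ R.left ≃ T.left) :
    (((wireIso (P := tensor P R) b b').symm ≪≫
      (.refl P ⊗ᵢ (wireIso (P := ⟨Empty, Empty⟩) a a').symm)) ≪≫ ρ_ P).hom =
      wireHom ((b.symm.trans (Equiv.sumCongr (.refl _) a.symm)).trans (Equiv.sumEmpty _ _))
        ((b'.symm.trans (Equiv.sumCongr (.refl _) a'.symm)).trans (Equiv.sumEmpty _ _)) := by
  change (wireHom _ _ ≫ tensorMap (wireHom _ _) (wireHom _ _)) ≫ wireHom _ _ = _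
  rw [tensorMap_wire, wire_comp_wire, wire_comp_wire]

end Iface

/-! ### Transport along the faithful embedding -/

namespace OMPG

open NetClass Iface

theorem categoryAxioms : CategoryAxioms OMPG where
  id_comp _ := toArrow_injective <| (toArrow_comp _ _).trans <|
    (congrArg (Iface.comp · _) (toArrow_id _)).trans (Category.id_comp (obj := Iface) _)
  comp_id _ := toArrow_injective <| (toArrow_comp _ _).trans <|
    (congrArg (Iface.comp _) (toArrow_id _)).trans (Category.comp_id (obj := Iface) _)
  assoc f g h := toArrow_injective <| (toArrow_comp _ _).trans <|
    (congrArg (Iface.comp · _) (toArrow_comp f g)).trans <| (Iface.comp_assoc' _ _ _).trans <|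
    (congrArg (Iface.comp _) (toArrow_comp g h).symm).trans (toArrow_comp _ _).symm

scoped instance category : Category OMPG := categoryAxioms.category

/-- Open mean payoff games among games with arbitrary open ends. -/
def toIface : OMPG ⥤ Iface where
  obj := iface
  map f := toArrow f
  map_id := toArrow_id
  map_comp := toArrow_comp

instance : toIface.Faithful := ⟨fun h => toArrow_injective h⟩

theorem sumObj_assoc (m k l : OMPG) : sumObj (sumObj m k) l = sumObj m (sumObj k l) :=
  OMPG.ext (Nat.add_assoc _ _ _) (Nat.add_assoc _ _ _).symm

theorem unit_sumObj (m : OMPG) : sumObj unit m = m := OMPG.ext (Nat.zero_add _) (Nat.add_zero _)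

theorem sumObj_unit (m : OMPG) : sumObj m unit = m := OMPG.ext (Nat.add_zero _) (Nat.zero_add _)

-- The structure isomorphisms are equalities of objects by construction, so strictness later holds
-- by `rfl`.
scoped instance monoidalCategoryStruct : MonoidalCategoryStruct OMPG where
  tensorObj := sumObj
  tensorHom := sumHom
  whiskerLeft m _ _ g := sumHom (𝟙 m) g
  whiskerRight f k := sumHom f (𝟙 k)
  tensorUnit := unit
  associator _ _ _ := eqToIso (sumObj_assoc _ _ _)
  leftUnitor _ := eqToIso (unit_sumObj _)
  rightUnitor _ := eqToIso (sumObj_unit _)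

theorem toIface_eqToHom {m n : OMPG} (h : m = n) :
    toIface.map (eqToHom h) = wireHom (P := iface m) (P' := iface n)
      (finCongr (congrArg right h)) (finCongr (congrArg left h)) := by
  subst h
  exact toIface.map_id m

/-- Open ends of a sum of objects. -/
def toIfaceTensor (m k : OMPG) : toIface.obj m ⊗ toIface.obj k ≅ toIface.obj (m ⊗ k) :=
  wireIso (P := tensor (iface m) (iface k)) (P' := iface (sumObj m k)) finSumFinEquiv
    -- `sumObj` puts the leftward ends of the second summand first.
    ((Equiv.sumComm _ _).trans finSumFinEquiv)

/-- The unit object has no open ends. -/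
def toIfaceUnit : 𝟙_ Iface ≅ toIface.obj (𝟙_ OMPG) :=
  wireIso (P := ⟨Empty, Empty⟩) (P' := iface unit) (Equiv.equivOfIsEmpty Empty (Fin 0))
    (Equiv.equivOfIsEmpty Empty (Fin 0))

theorem toIface_tensorHom {m n k l : OMPG} (f : m ⟶ n) (g : k ⟶ l) :
    toIface.map (f ⊗ₘ g) =
      (toIfaceTensor m k).inv ≫ (toIface.map f ⊗ₘ toIface.map g) ≫ (toIfaceTensor n l).hom := by
  refine (toArrow_sumHom f g).trans (.trans ?_ (wire_comp_tensorMap_comp_wire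
    (P := iface m) (P' := iface n) (R := iface k) (R' := iface l) (T := iface (sumObj m k))
    (T' := iface (sumObj n l)) _ _ (toArrow f) (toArrow g) _ _).symm)
  apply reindex_congr <;> rintro (_ | _) <;> rfl

/-- The embedding transports the monoidal structure. -/
def toIfaceData : Monoidal.InducingFunctorData toIface where
  μIso := toIfaceTensor
  εIso := toIfaceUnit
  tensorHom_eq := toIface_tensorHom
  whiskerLeft_eq m _ _ g := (toIface_tensorHom (𝟙 m) g).trans (by
    rw [toIface.map_id, id_tensorHom])
  whiskerRight_eq f k := (toIface_tensorHom f (𝟙 k)).trans (by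
    rw [toIface.map_id, tensorHom_id])
  associator_eq m k l := by
    refine ((toIface_eqToHom (sumObj_assoc m k l)).trans (wireHom_congr ?_ ?_)).trans
      (wire_associator _ _ _ _ _ _ _ _).symm
    · exact fun c => Fin.sumAssoc_apply _ c
    · exact fun c => Fin.sumAssoc_comm_apply _ c
  leftUnitor_eq m := by
    refine ((toIface_eqToHom (unit_sumObj m)).trans (wireHom_congr ?_ ?_)).trans
      (wire_leftUnitor _ _ _ _).symm
    · exact fun c => Fin.emptySum_apply _ c
    · exact fun c => Fin.emptySum_comm_apply _ c
  rightUnitor_eq m := by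
    refine ((toIface_eqToHom (sumObj_unit m)).trans (wireHom_congr ?_ ?_)).trans
      (wire_rightUnitor _ _ _ _).symm
    · exact fun c => Fin.sumEmpty_apply _ c
    · exact fun c => Fin.sumEmpty_comm_apply _ c

scoped instance monoidalCategory : MonoidalCategory OMPG := Monoidal.induced toIface toIfaceData

instance : toIface.Monoidal := Monoidal.fromInducedMonoidal toIface toIfaceData

/-! ### Symmetry of open mean payoff games -/

theorem toArrow_swapHom (m k : OMPG) :
    toArrow (m := sumObj m k) (n := sumObj k m) (swapHom m k) =
      wire (P := iface (sumObj m k)) (P' := iface (sumObj k m)) finAddFlip finAddFlip := by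
  refine (congrArg toArrow (ROHom.sum_wires _ _)).trans ((toArrow_wires _).trans ?_)
  refine congrArg wires (funext ?_)
  rintro (c | c) <;> simp <;> rfl

/-- The symmetry. -/
def swapIso (m k : OMPG) : m ⊗ k ≅ k ⊗ m where
  hom := swapHom m k
  inv := swapHom k m
  hom_inv_id := toIface.map_injective <| by
    refine (toIface.map_comp _ _).trans (.trans ?_ (toIface.map_id _).symm)
    refine (congrArg₂ (· ≫ ·) (toArrow_swapHom m k) (toArrow_swapHom k m)).trans ?_
    refine (wire_comp_wire _ _ _ _).trans (wireHom_congr ?_ ?_) <;>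
      exact fun c => finAddFlip.symm_apply_apply c
  inv_hom_id := toIface.map_injective <| by
    refine (toIface.map_comp _ _).trans (.trans ?_ (toIface.map_id _).symm)
    refine (congrArg₂ (· ≫ ·) (toArrow_swapHom k m) (toArrow_swapHom m k)).trans ?_
    refine (wire_comp_wire _ _ _ _).trans (wireHom_congr ?_ ?_) <;>
      exact fun c => finAddFlip.symm_apply_apply c

theorem toIfaceTensor_swapIso (m k : OMPG) :
    Functor.LaxMonoidal.μ toIface m k ≫ toIface.map (swapIso m k).hom =
      (β_ (toIface.obj m) (toIface.obj k)).hom ≫ Functor.LaxMonoidal.μ toIface k m := by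
  refine (congrArg ((toIfaceTensor m k).hom ≫ ·) (toArrow_swapHom m k)).trans ?_
  refine (wire_comp_wire _ _ _ _).trans (.trans (wireHom_congr ?_ ?_) (wire_comp_wire _ _ _ _).symm)
  · exact fun c => congrArg (finSumFinEquiv ∘ Sum.swap) (finSumFinEquiv.symm_apply_apply c)
  · exact fun c => congrArg (finSumFinEquiv ∘ Sum.swap) (finSumFinEquiv.symm_apply_apply c.swap)

scoped instance braidedCategory : BraidedCategory OMPG :=
  .ofFaithful toIface swapIso toIfaceTensor_swapIso

instance : toIface.Braided where
  braided m k := by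
    rw [← toIfaceTensor_swapIso]
    rfl

scoped instance symmetricCategory : SymmetricCategory OMPG := .ofFaithful toIface

/-! ### Duality of open mean payoff games -/

theorem toIface_coev (m : OMPG) :
    toIface.map (Y := m ⊗ dual m) (coev m) = Functor.OplaxMonoidal.η toIface ≫
      Iface.coev (iface m) ≫ Functor.LaxMonoidal.μ toIface m (dual m) := by
  refine ((congrArg toArrow (ROHom.cast_wires _ _ _)).trans (toArrow_wires _)).trans
    (.trans (congrArg wires (funext ?_)) (wire_comp_wires_comp_wire
      (P := ⟨Empty, Empty⟩) (P' := tensor (iface m) (Iface.dual (iface m))) (T := iface unit)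
      (T' := iface (sumObj m (dual m))) _ _ (Sum.elim Empty.elim (.inl ∘ Sum.swap)) _ _).symm)
  exact fun c => Fin.coev_apply _ _ c

theorem toIface_ev (m : OMPG) :
    toIface.map (X := dual m ⊗ m) (ev m) = Functor.OplaxMonoidal.δ toIface (dual m) m ≫
      Iface.ev (iface m) ≫ Functor.LaxMonoidal.ε toIface := by
  refine ((congrArg toArrow (ROHom.cast_wires _ _ _)).trans (toArrow_wires _)).trans
    (.trans (congrArg wires (funext ?_)) (wire_comp_wires_comp_wire
      (P := tensor (Iface.dual (iface m)) (iface m)) (P' := ⟨Empty, Empty⟩)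
      (T := iface (sumObj (dual m) m)) (T' := iface unit) _ _
      (Sum.elim (.inr ∘ Sum.swap) Empty.elim) _ _).symm)
  exact fun c => Fin.ev_apply _ _ c

-- Up to the comparison isomorphisms the embedding sends the turning wires to those of `Iface`, so
-- faithfulness reflects the triangle identities.
scoped instance compactClosedCategory : CompactClosedCategory OMPG where
  dual := dual
  exactPairing m :=
    letI : ExactPairing (toIface.obj m) (toIface.obj (dual m)) := Iface.exactPairing (iface m)
    .ofFaithful toIface (ev m) (coev m) (toIface_ev m) (toIface_coev m)

end OMPG

/-- `HEq` appears because the tensor product of the asserted structure is only propositionally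
`sumObj`. For the structure supplied here the types agree definitionally, so reflexivity suffices.
-/
theorem mainTheorem2 :
    ∃ h : CategoryAxioms OMPG,
      letI : Category OMPG := h.category
      ∃ (_ : MonoidalCategory OMPG) (K : CompactClosedCategory OMPG),
        -- the tensor product is the sum of open games, with unit object `(0, 0)`
        (∀ X Y : OMPG, X ⊗ Y = OMPG.sumObj X Y) ∧
        𝟙_ OMPG = OMPG.unit ∧
        (∀ {X X' Y Y' : OMPG} (f : X ⟶ X') (g : Y ⟶ Y'), HEq (f ⊗ₘ g) (OMPG.sumHom f g)) ∧
        -- the monoidal structure is strict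
        (∀ X Y Z : OMPG, ∃ e : (X ⊗ Y) ⊗ Z = X ⊗ (Y ⊗ Z), (α_ X Y Z).hom = eqToHom e) ∧
        (∀ X : OMPG, ∃ e : 𝟙_ OMPG ⊗ X = X, (λ_ X).hom = eqToHom e) ∧
        (∀ X : OMPG, ∃ e : X ⊗ 𝟙_ OMPG = X, (ρ_ X).hom = eqToHom e) ∧
        -- the symmetry is the swap of wires
        (∀ X Y : OMPG, HEq (β_ X Y : X ⊗ Y ≅ Y ⊗ X).hom (OMPG.swapHom X Y)) ∧
        -- the duality is given by wires that turn around
        (∀ X : OMPG, K.dual X = OMPG.dual X) ∧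
        (∀ X : OMPG, HEq (K.exactPairing X).coevaluation' (OMPG.coev X)) ∧
        (∀ X : OMPG, HEq (K.exactPairing X).evaluation' (OMPG.ev X)) :=
  ⟨OMPG.categoryAxioms, OMPG.monoidalCategory, OMPG.compactClosedCategory, fun _ _ => rfl, rfl,
    fun _ _ => HEq.rfl, fun _ _ _ => ⟨OMPG.sumObj_assoc _ _ _, rfl⟩,
    fun _ => ⟨OMPG.unit_sumObj _, rfl⟩, fun _ => ⟨OMPG.sumObj_unit _, rfl⟩,
    fun _ _ => HEq.rfl, fun _ => rfl, fun _ => HEq.rfl, fun _ => HEq.rfl⟩
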